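/- Throughout, rings are commutative with identity and $\otimes=\otimes_C$. Let $C$ be a ring, $\lambda\in C$, and let $A$ be a $C$-algebra. Let $\mathrm{Sh}_C(A)=\mathrm{Sh}_{C,\lambda}(A)=\bigoplus_{k\ge 0}A^{\otimes(k+1)}$ be the shuffle Baxter algebra of weight $\lambda$ on $A$, with Baxter operator $P_A(x_0\otimes\cdots\otimes x_n)=1_A\otimes x_0\otimes\cdots\otimes x_n$ and with the mixed shuffle product: for $x=x_0\otimes x_1\otimes\cdots\otimes x_m$ and $y=y_0\otimes y_1\otimes\cdots\otimes y_n$, $$x\,y=\sum_{(\sigma,T)}\lambda^{|T|}\;x_0y_0\otimes\sigma\bigl((x_1\otimes\cdots\otimes x_m)\otimes(y_1\otimes\cdots\otimes y_n);T\bigr).$$ Here $\sigma$ runs over the permutations of $\{1,\dots,m+n\}$ with $\sigma^{-1}(1)<\cdots<\sigma^{-1}(m)$ and $\sigma^{-1}(m+1)<\cdots<\sigma^{-1}(m+n)$, and $T$ runs over the sets of pairs $(k,k+1)$ with $1\le k<m+n$ and $\sigma(k)\le m<\sigma(k+1)$. With $(u_1,\dots,u_{m+n})=(x_1,\dots,x_m,y_1,\dots,y_n)$,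 the element $\sigma(\,\cdot\,;T)\in A^{\otimes(m+n-|T|)}$ is obtained from $u_{\sigma(1)}\otimes\cdots\otimes u_{\sigma(m+n)}$ by replacing, for each $(k,k+1)\in T$, the symbol $\otimes$ between $u_{\sigma(k)}$ and $u_{\sigma(k+1)}$ by the product of $A$. A Baxter ideal of $\mathrm{Sh}_C(A)$ is an ideal that is stable under $P_A$. Let $I$ be a prime ideal of $A$, and let $\tilde I$ be the Baxter ideal of $\mathrm{Sh}_C(A)$ generated by $I\subseteq A=A^{\otimes 1}\subseteq \mathrm{Sh}_C(A)$, that is, the smallest Baxter ideal containing $I$. Let $\bar\varphi:C\to A/I$ be the structure map of the $C$-algebra $A/I$. Then $\tilde I$ is a prime ideal of $\mathrm{Sh}_C(A)$ if and only if 1. $A/I$ has characteristic zero, and 2. for every $n\ge1$ the $C/\ker\bar\varphi$-module $(A/I)^{\otimes n}$ is torsion-free: if $x\in(A/I)^{\otimes n}$ and $rx=0$ for some $r\in C\setminus\ker\bar\varphi$, then $x=0$. -/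

import Mathlib

open scoped TensorProduct DirectSum

namespace BaxterAlgebra

/-! ### Mixable shuffles -/

/-- An `(m, n)`-mixable shuffle `(σ, T)`, with positions and indices counted from `0`: `σ` is a
permutation of `{0, …, m + n - 1}` such that `σ⁻¹` is increasing on the first `m` indices and on the
last `n` indices, and `T` is a set of admissible pairs for `σ`, the pair `(k, k + 1)` being recorded
by its first entry `k`. The pair `(k, k + 1)` is admissible if `σ k` is one of the first `m` indices
and `σ (k + 1)` is one of the last `n`. -/
structure MixableShuffle (m n : ℕ) where
  σ : Equiv.Perm (Fin (m + n))
  T : Finset (Fin (m + n))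
  mono_left : StrictMono fun i : Fin m => σ.symm (Fin.castAdd n i)
  mono_right : StrictMono fun j : Fin n => σ.symm (Fin.natAdd m j)
  admissible : ∀ k ∈ T, ∃ h : (k : ℕ) + 1 < m + n,
    ((σ k : Fin (m + n)) : ℕ) < m ∧ m ≤ ((σ ⟨k + 1, h⟩ : Fin (m + n)) : ℕ)

namespace MixableShuffle

variable {m n : ℕ}

theorem injective_pair :
    Function.Injective fun s : MixableShuffle m n => (s.σ, s.T) := by
  rintro ⟨σ, T, _, _, _⟩ ⟨σ', T', _, _, _⟩ h
  simp only [Prod.mk.injEq] at h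
  obtain ⟨rfl, rfl⟩ := h
  rfl

noncomputable instance : Fintype (MixableShuffle m n) :=
  Fintype.ofInjective _ injective_pair

theorem blockIdx_lt (s : MixableShuffle m n) (p : Fin (m + n)) :
    (Finset.univ.filter fun q => q < p ∧ q ∉ s.T).card < m + n - s.T.card := by
  have hpos : 0 < m + n := p.pos
  set l : Fin (m + n) := ⟨m + n - 1, by omega⟩ with hl
  have hlT : l ∉ s.T := by
    intro h
    obtain ⟨h1, _⟩ := s.admissible l h
    simp only [hl] at h1
    omega
  have h1 : (Finset.univ.filter fun q => q < p ∧ q ∉ s.T) ⊂ s.Tᶜ := by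
    rw [Finset.ssubset_iff_of_subset]
    · refine ⟨l, by simpa using hlT, ?_⟩
      simp only [Finset.mem_filter, Finset.mem_univ, true_and, not_and]
      intro h
      have := p.isLt
      simp only [hl, Fin.lt_def] at h
      omega
    · intro q hq
      simpa using (Finset.mem_filter.mp hq).2.2
  have h2 := Finset.card_lt_card h1
  rwa [Finset.card_compl, Fintype.card_fin] at h2

/-- Merging each pair `(k, k + 1)` with `k ∈ T` groups the `m + n` positions into `m + n - |T|`
consecutive blocks; `s.block p` is the block of the position `p`. -/
def block (s : MixableShuffle m n) (p : Fin (m + n)) : Fin (m + n - s.T.card) :=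
  ⟨(Finset.univ.filter fun q => q < p ∧ q ∉ s.T).card, s.blockIdx_lt p⟩

/-- The tensor factors of the mixable shuffle product term of `x₀ ⊗ x₁ ⊗ … ⊗ xₘ` and
`y₀ ⊗ y₁ ⊗ … ⊗ yₙ` that belongs to `(σ, T)`: the leading factor is `x₀ y₀`. It is followed by the
factors of `σ (x⁺ ⊗ y⁺; T)`, that is, by `u_{σ(1)}, …, u_{σ(m+n)}` with `u = (x⁺, y⁺)`, where the
factors in the same block are multiplied. -/
def word {A : Type*} [CommRing A] (s : MixableShuffle m n)
    (x : Fin (m + 1) → A) (y : Fin (n + 1) → A) : Fin (m + n - s.T.card + 1) → A :=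
  Fin.cons (x 0 * y 0) fun j =>
    ∏ p ∈ Finset.univ.filter (fun p => s.block p = j),
      (Fin.append (Fin.tail x) (Fin.tail y) : Fin (m + n) → A) (s.σ p)

/-- The position in `s.word x y` to which the factors of `x` go. -/
def left (s : MixableShuffle m n) : Fin (m + 1) → Fin (m + n - s.T.card + 1) :=
  Fin.cons 0 fun i => (s.block (s.σ.symm (Fin.castAdd n i))).succ

/-- The position in `s.word x y` to which the factors of `y` go. -/
def right (s : MixableShuffle m n) : Fin (n + 1) → Fin (m + n - s.T.card + 1) :=
  Fin.cons 0 fun i => (s.block (s.σ.symm (Fin.natAdd m i))).succ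

end MixableShuffle

/-! ### Products along the fibres of a map -/

/-- `push F x j` is the product of the `x i` with `F i = j`. -/
def push {ι κ A : Type*} [Fintype ι] [DecidableEq κ] [CommRing A] (F : ι → κ) (x : ι → A) :
    κ → A :=
  fun j => ∏ i ∈ Finset.univ.filter (fun i => F i = j), x i

section push

variable {ι κ μ A : Type*} [Fintype ι] [DecidableEq κ] [DecidableEq μ] [CommRing A]

theorem push_push [Fintype κ] (H : κ → μ) (F : ι → κ) (x : ι → A) :
    push H (push F x) = push (H ∘ F) x := by
  funext j
  simp only [push]
  rw [Finset.prod_sigma']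
  refine Finset.prod_bij' (fun a _ => a.2) (fun a _ => ⟨F a, a⟩) ?_ ?_ ?_ ?_ ?_ <;>
    simp +contextual

theorem push_mul (F : ι → κ) (x y : ι → A) : push F (x * y) = push F x * push F y := by
  funext j
  simp [push, Finset.prod_mul_distrib]

theorem push_update [DecidableEq ι] (F : ι → κ) (x : ι → A) (i : ι) (a : A) :
    push F (Function.update x i a) = Function.update (push F x) (F i)
      (a * ∏ i' ∈ (Finset.univ.filter fun i' => F i' = F i) \ {i}, x i') := by
  funext j
  rcases eq_or_ne j (F i) with rfl | hj
  · simp only [push, Function.update_self]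
    rw [Finset.prod_update_of_mem (by simp)]
  · simp only [push, Function.update_of_ne hj]
    refine Finset.prod_congr rfl fun i' hi' => ?_
    have : i' ≠ i := by
      rintro rfl
      exact hj (Finset.mem_filter.mp hi').2.symm
    simp [this]

theorem push_sumElim {ι' : Type*} [Fintype ι'] (F : ι → κ) (G : ι' → κ) (u : ι ⊕ ι' → A) :
    push (Sum.elim F G) u = push F (u ∘ Sum.inl) * push G (u ∘ Sum.inr) := by
  funext j
  simp only [push, Pi.mul_apply, Finset.prod_filter]
  rw [Fintype.prod_sum_type]
  rfl

theorem push_id [DecidableEq ι] (x : ι → A) : push (fun i => i) x = x := by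
  funext j
  simp only [push, Finset.prod_filter]
  simp

theorem push_one (F : ι → κ) : push F (1 : ι → A) = 1 := by
  funext j
  simp [push]

end push

theorem MixableShuffle.word_eq {m n : ℕ} {A : Type*} [CommRing A] (s : MixableShuffle m n)
    (x : Fin (m + 1) → A) (y : Fin (n + 1) → A) :
    s.word x y = push s.left x * push s.right y := by
  funext j
  refine Fin.cases ?_ (fun j => ?_) j
  · simp [word, push, left, right, Finset.prod_filter, Fin.prod_univ_succ, Fin.succ_ne_zero]
  · simp only [word, Fin.cons_succ, push, left, right, Finset.prod_filter, Pi.mul_apply]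
    rw [Fin.prod_univ_succ, Fin.prod_univ_succ, ← s.σ.symm.prod_comp, Fin.prod_univ_add]
    simp [Fin.tail, (Fin.succ_ne_zero _).symm]

/-! ### Mixable shuffles as pairs of increasing maps -/

/-- A pair of increasing maps that are jointly surjective and respect the leading positions. -/
structure Stuffle (m n : ℕ) where
  k : ℕ
  F : Fin (m + 1) → Fin (k + 1)
  G : Fin (n + 1) → Fin (k + 1)
  monoF : StrictMono F
  monoG : StrictMono G
  F0 : F 0 = 0
  G0 : G 0 = 0
  surj : ∀ j, (∃ i, F i = j) ∨ ∃ i, G i = j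

namespace Stuffle

variable {m n p : ℕ}

theorem k_le_of (s s' : Stuffle m n) (hF : ∀ i, (s.F i : ℕ) = s'.F i)
    (hG : ∀ i, (s.G i : ℕ) = s'.G i) : s.k ≤ s'.k := by
  rcases s.surj (Fin.last _) with ⟨i, hi⟩ | ⟨i, hi⟩
  · have := hF i
    rw [hi, Fin.val_last] at this
    omega
  · have := hG i
    rw [hi, Fin.val_last] at this
    omega

theorem ext_val {s s' : Stuffle m n} (hF : ∀ i, (s.F i : ℕ) = s'.F i)
    (hG : ∀ i, (s.G i : ℕ) = s'.G i) : s = s' := by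
  have hk : s.k = s'.k := le_antisymm (k_le_of s s' hF hG)
    (k_le_of s' s (fun i => (hF i).symm) fun i => (hG i).symm)
  obtain ⟨k, F, G, _, _, _, _, _⟩ := s
  obtain ⟨k', F', G', _, _, _, _, _⟩ := s'
  dsimp only at hk hF hG
  subst hk
  obtain rfl : F = F' := funext fun i => Fin.ext (hF i)
  obtain rfl : G = G' := funext fun i => Fin.ext (hG i)
  rfl

theorem k_le (s : Stuffle m n) : s.k ≤ m + n := by
  have h : (Finset.univ : Finset (Fin s.k)) ⊆
      (Finset.univ.image fun i : Fin m => s.F i.succ).preimage Fin.succ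
        (Fin.succ_injective _).injOn ∪
      (Finset.univ.image fun i : Fin n => s.G i.succ).preimage Fin.succ
        (Fin.succ_injective _).injOn := by
    intro j _
    simp only [Finset.mem_union, Finset.mem_preimage, Finset.mem_image, Finset.mem_univ, true_and]
    rcases s.surj j.succ with ⟨i, hi⟩ | ⟨i, hi⟩
    · refine Or.inl ?_
      induction i using Fin.cases with
      | zero => rw [s.F0] at hi; exact absurd hi.symm (Fin.succ_ne_zero _)
      | succ i => exact ⟨i, hi⟩
    · refine Or.inr ?_
      induction i using Fin.cases with
      | zero => rw [s.G0] at hi; exact absurd hi.symm (Fin.succ_ne_zero _)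
      | succ i => exact ⟨i, hi⟩
  have h1 := (Finset.card_le_card h).trans (Finset.card_union_le _ _)
  have h2 : ∀ (r : ℕ) (f : Fin r → Fin (s.k + 1)),
      ((Finset.univ.image f).preimage Fin.succ (Fin.succ_injective _).injOn).card ≤ r := by
    intro r f
    rw [← Finset.card_image_of_injective _ (Fin.succ_injective s.k)]
    refine (Finset.card_le_card (t := Finset.univ.image f) ?_).trans ?_
    · exact Finset.image_subset_iff.mpr fun a ha => Finset.mem_preimage.mp ha
    exact Finset.card_image_le.trans (by simp)
  have h3 := h2 _ fun i : Fin m => s.F i.succ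
  have h4 := h2 _ fun i : Fin n => s.G i.succ
  simp only [Finset.card_univ, Fintype.card_fin] at h1
  omega

/-- Exchange of the two maps. -/
def swap (s : Stuffle m n) : Stuffle n m :=
  ⟨s.k, s.G, s.F, s.monoG, s.monoF, s.G0, s.F0, fun j => (s.surj j).symm⟩

end Stuffle

namespace MixableShuffle

variable {m n : ℕ}

theorem block_succ (s : MixableShuffle m n) (p : Fin (m + n)) (h : (p : ℕ) + 1 < m + n) :
    (s.block ⟨p + 1, h⟩ : ℕ) = s.block p + if p ∈ s.T then 0 else 1 := by
  simp only [block]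
  split_ifs with hp
  · rw [add_zero]
    congr 1
    ext q
    simp only [Finset.mem_filter, Finset.mem_univ, true_and, Fin.lt_def]
    refine and_congr_left fun hq => ⟨fun h1 => ?_, fun h1 => by omega⟩
    have : (q : ℕ) ≠ p := fun h2 => hq (by rwa [Fin.ext h2])
    omega
  · rw [← Finset.card_insert_of_notMem (a := p) (by simp)]
    congr 1
    ext q
    simp only [Finset.mem_filter, Finset.mem_univ, true_and, Fin.lt_def, Finset.mem_insert]
    constructor
    · rintro ⟨h1, h2⟩
      by_cases h3 : q = p
      · exact Or.inl h3
      · have : (q : ℕ) ≠ p := fun h4 => h3 (Fin.ext h4)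
        exact Or.inr ⟨by omega, h2⟩
    · rintro (rfl | ⟨h1, h2⟩)
      · exact ⟨by omega, hp⟩
      · exact ⟨by omega, h2⟩

theorem block_zero (s : MixableShuffle m n) (h : 0 < m + n) : (s.block ⟨0, h⟩ : ℕ) = 0 := by
  simp [block, Fin.lt_def]

theorem block_last (s : MixableShuffle m n) (h : 0 < m + n) :
    (s.block ⟨m + n - 1, by omega⟩ : ℕ) + 1 = m + n - s.T.card := by
  have hlT : (⟨m + n - 1, by omega⟩ : Fin (m + n)) ∉ s.T := by
    intro h
    obtain ⟨h1, _⟩ := s.admissible _ h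
    dsimp only at h1
    omega
  simp only [block]
  rw [← Finset.card_insert_of_notMem (a := (⟨m + n - 1, by omega⟩ : Fin (m + n))) (by simp)]
  have : insert (⟨m + n - 1, by omega⟩ : Fin (m + n))
      (Finset.univ.filter fun q => q < (⟨m + n - 1, by omega⟩ : Fin (m + n)) ∧ q ∉ s.T)
      = s.Tᶜ := by
    ext q
    simp only [Finset.mem_filter, Finset.mem_univ, true_and, Fin.lt_def, Finset.mem_insert,
      Finset.mem_compl]
    constructor
    · rintro (rfl | ⟨h1, h2⟩)
      · exact hlT
      · exact h2
    · intro h1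
      by_cases h3 : q = ⟨m + n - 1, by omega⟩
      · exact Or.inl h3
      · have h4 : (q : ℕ) ≠ m + n - 1 := fun h4 => h3 (Fin.ext h4)
        exact Or.inr ⟨by omega, h1⟩
  rw [this, Finset.card_compl, Fintype.card_fin]

theorem exists_block (s : MixableShuffle m n) (j : Fin (m + n - s.T.card)) :
    ∃ p, s.block p = j := by
  have hpos : 0 < m + n := by have := j.isLt; omega
  have key : ∀ r (hr : r < m + n), ∀ i : ℕ, i ≤ (s.block ⟨r, hr⟩ : ℕ) → ∃ p, (s.block p : ℕ) = i := by
    intro r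
    induction r with
    | zero =>
      intro hr i hi
      rw [s.block_zero] at hi
      exact ⟨⟨0, hr⟩, by rw [s.block_zero]; omega⟩
    | succ r ih =>
      intro hr i hi
      have h1 := s.block_succ ⟨r, by omega⟩ hr
      dsimp only at h1
      by_cases h2 : i = s.block ⟨r + 1, hr⟩
      · exact ⟨_, h2.symm⟩
      · refine ih (by omega) i ?_
        split_ifs at h1 <;> omega
  obtain ⟨p, hp⟩ := key (m + n - 1) (by omega) j (by
    have := s.block_last hpos
    have := j.isLt
    omega)
  exact ⟨p, Fin.ext hp⟩

theorem block_mono (s : MixableShuffle m n) : Monotone s.block := by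
  intro p q h
  change (Finset.univ.filter fun r => r < p ∧ r ∉ s.T).card ≤
    (Finset.univ.filter fun r => r < q ∧ r ∉ s.T).card
  refine Finset.card_le_card fun r hr => ?_
  simp only [Finset.mem_filter, Finset.mem_univ, true_and] at hr ⊢
  exact ⟨hr.1.trans_le h, hr.2⟩

theorem block_lt_or (s : MixableShuffle m n) {p q : Fin (m + n)} (h : p < q) :
    s.block p < s.block q ∨
      s.block p = s.block q ∧ ((s.σ p : Fin (m + n)) : ℕ) < m ∧
        m ≤ ((s.σ q : Fin (m + n)) : ℕ) := by
  rcases (s.block_mono h.le).lt_or_eq with h1 | h1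
  · exact Or.inl h1
  refine Or.inr ⟨h1, ?_⟩
  have hp1 : (p : ℕ) + 1 < m + n := by
    have := q.isLt
    rw [Fin.lt_def] at h
    omega
  have h2 := s.block_succ p hp1
  have h3 : s.block ⟨p + 1, hp1⟩ ≤ s.block q := s.block_mono (by
    rw [Fin.lt_def] at h
    rw [Fin.le_def]
    exact h)
  rw [← h1, Fin.le_def] at h3
  have hpT : p ∈ s.T := by
    by_contra hp
    rw [if_neg hp] at h2
    omega
  obtain ⟨_, h4, h5⟩ := s.admissible p hpT
  have hq : q = ⟨p + 1, hp1⟩ := by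
    by_contra hq
    have hq1 : (q : ℕ) ≠ p + 1 := fun h => hq (Fin.ext h)
    rw [Fin.lt_def] at h
    have hp2 : (p : ℕ) + 1 + 1 < m + n := by have := q.isLt; omega
    have h6 := s.block_succ ⟨p + 1, hp1⟩ hp2
    have h7 : s.block ⟨p + 1 + 1, hp2⟩ ≤ s.block q := s.block_mono (by
      rw [Fin.le_def]
      dsimp only
      omega)
    rw [← h1, Fin.le_def] at h7
    have hT : (⟨p + 1, hp1⟩ : Fin (m + n)) ∈ s.T := by
      by_contra hT
      rw [if_neg hT] at h6
      rw [if_pos hpT] at h2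
      dsimp only at h6
      omega
    obtain ⟨_, h8, _⟩ := s.admissible _ hT
    omega
  subst hq
  exact ⟨h4, h5⟩

theorem left_succ (s : MixableShuffle m n) (i : Fin m) :
    s.left i.succ = (s.block (s.σ.symm (Fin.castAdd n i))).succ := rfl

theorem right_succ (s : MixableShuffle m n) (i : Fin n) :
    s.right i.succ = (s.block (s.σ.symm (Fin.natAdd m i))).succ := rfl

theorem strictMono_cons {r k : ℕ} {f : Fin r → Fin k} (hf : StrictMono f) :
    StrictMono (Fin.cons 0 fun i => (f i).succ : Fin (r + 1) → Fin (k + 1)) := by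
  intro a b hab
  induction b using Fin.cases with
  | zero => exact absurd hab (Fin.not_lt_zero _)
  | succ b =>
    induction a using Fin.cases with
    | zero => simp
    | succ a => simpa using hf (by simpa using hab)

/-- The increasing maps that belong to a mixable shuffle. -/
def toStuffle (s : MixableShuffle m n) : Stuffle m n where
  k := m + n - s.T.card
  F := s.left
  G := s.right
  monoF := by
    refine strictMono_cons fun a b hab => ?_
    rcases s.block_lt_or (s.mono_left hab) with h | ⟨_, _, h⟩
    · exact h
    · simp only [Equiv.apply_symm_apply, Fin.val_castAdd] at h
      have := b.isLt
      omega
  monoG := by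
    refine strictMono_cons fun a b hab => ?_
    rcases s.block_lt_or (s.mono_right hab) with h | ⟨_, h, _⟩
    · exact h
    · simp only [Equiv.apply_symm_apply, Fin.val_natAdd] at h
      omega
  F0 := rfl
  G0 := rfl
  surj := by
    intro j
    induction j using Fin.cases with
    | zero => exact Or.inl ⟨0, rfl⟩
    | succ j =>
      obtain ⟨p, rfl⟩ := s.exists_block j
      obtain ⟨q, rfl⟩ := s.σ.symm.surjective p
      induction q using Fin.addCases with
      | left i => exact Or.inl ⟨i.succ, rfl⟩
      | right i => exact Or.inr ⟨i.succ, rfl⟩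

end MixableShuffle

namespace Stuffle

variable {m n : ℕ}

/-- The sorting key of an index. -/
def key (s : Stuffle m n) : Fin (m + n) → ℕ :=
  Fin.append (fun i => 2 * (s.F i.succ : ℕ)) fun i => 2 * (s.G i.succ : ℕ) + 1

theorem key_left (s : Stuffle m n) (i : Fin m) :
    s.key (Fin.castAdd n i) = 2 * (s.F i.succ : ℕ) := by simp [key]

theorem key_right (s : Stuffle m n) (i : Fin n) :
    s.key (Fin.natAdd m i) = 2 * (s.G i.succ : ℕ) + 1 := by simp [key]

theorem key_even (s : Stuffle m n) (i : Fin (m + n)) : s.key i % 2 = 0 ↔ (i : ℕ) < m := by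
  induction i using Fin.addCases with
  | left i => rw [key_left]; simp
  | right i => rw [key_right]; simp

theorem key_injective (s : Stuffle m n) : Function.Injective s.key := by
  intro a b h
  induction a using Fin.addCases with
  | left a =>
    induction b using Fin.addCases with
    | left b =>
      rw [key_left, key_left] at h
      have := s.monoF.injective (Fin.ext (by omega) : s.F a.succ = s.F b.succ)
      rw [Fin.succ_injective _ this]
    | right b => rw [key_left, key_right] at h; omega
  | right a =>
    induction b using Fin.addCases with
    | left b => rw [key_left, key_right] at h; omega
    | right b =>
      rw [key_right, key_right] at h
      have := s.monoG.injective (Fin.ext (by omega) : s.G a.succ = s.G b.succ)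
      rw [Fin.succ_injective _ this]

end Stuffle

namespace MixableShuffle

variable {m n : ℕ}

theorem key_toStuffle (s : MixableShuffle m n) (p : Fin (m + n)) :
    s.toStuffle.key (s.σ p) =
      2 * ((s.block p : ℕ) + 1) + if ((s.σ p : Fin (m + n)) : ℕ) < m then 0 else 1 := by
  obtain ⟨q, rfl⟩ := s.σ.symm.surjective p
  rw [Equiv.apply_symm_apply]
  induction q using Fin.addCases with
  | left i => rw [Stuffle.key_left]; simp [toStuffle, left_succ]
  | right i => rw [Stuffle.key_right]; simp [toStuffle, right_succ]

theorem toStuffle_injective : Function.Injective (toStuffle : MixableShuffle m n → _) := by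
  intro s s' h
  have hm : ∀ t : MixableShuffle m n, StrictMono fun p => t.toStuffle.key (t.σ p) := by
    intro t p q hpq
    dsimp only
    rw [key_toStuffle, key_toStuffle]
    rcases t.block_lt_or hpq with h | ⟨h, h1, h2⟩
    · rw [Fin.lt_def] at h
      split_ifs <;> omega
    · rw [h, if_pos h1, if_neg (by omega)]
      omega
  have h1 : ∀ p, s.toStuffle.key (s.σ p) = s'.toStuffle.key (s'.σ p) := by
    rw [← funext_iff]
    rw [← StrictMono.range_inj (hm s) (hm s')]
    have : ∀ t : MixableShuffle m n, Set.range (fun p => t.toStuffle.key (t.σ p)) =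
        Set.range t.toStuffle.key := fun t => t.σ.surjective.range_comp _
    rw [this, this, h]
  have hσ : s.σ = s'.σ := by
    ext p
    have h2 := h1 p
    rw [h] at h2
    rw [s'.toStuffle.key_injective h2]
  have hb : ∀ p, (s.block p : ℕ) = s'.block p := by
    intro p
    have h2 := h1 p
    rw [key_toStuffle, key_toStuffle, hσ] at h2
    split_ifs at h2 <;> omega
  have hT : ∀ t t' : MixableShuffle m n, (∀ p, (t.block p : ℕ) = t'.block p) → t.T ⊆ t'.T := by
    intro t t' hb p hp
    obtain ⟨h3, _⟩ := t.admissible p hp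
    have h4 := t.block_succ p h3
    have h5 := t'.block_succ p h3
    rw [if_pos hp, hb, hb] at h4
    by_contra h6
    rw [if_neg h6] at h5
    omega
  refine injective_pair ?_
  simp only [Prod.mk.injEq]
  exact ⟨hσ, (hT s s' hb).antisymm (hT s' s fun p => (hb p).symm)⟩

end MixableShuffle

namespace Stuffle

variable {m n : ℕ}

/-- The mixable shuffle that belongs to a pair of increasing maps. -/
def toMixable (s : Stuffle m n) : MixableShuffle m n :=
  have hmono : StrictMono (s.key ∘ Tuple.sort s.key) :=
    (Tuple.monotone_sort s.key).strictMono_of_injective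
      (s.key_injective.comp (Equiv.injective _))
  have hsymm : ∀ i j, s.key i < s.key j →
      (Tuple.sort s.key).symm i < (Tuple.sort s.key).symm j := fun i j h => by
    rw [← hmono.lt_iff_lt]
    simpa using h
  { σ := Tuple.sort s.key
    T := Finset.univ.filter fun p => ∃ h : (p : ℕ) + 1 < m + n,
      s.key (Tuple.sort s.key p) / 2 = s.key (Tuple.sort s.key ⟨p + 1, h⟩) / 2
    mono_left := fun i j hij => hsymm _ _ (by
      rw [key_left, key_left]
      have := s.monoF (Fin.succ_lt_succ_iff.mpr hij)
      rw [Fin.lt_def] at this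
      omega)
    mono_right := fun i j hij => hsymm _ _ (by
      rw [key_right, key_right]
      have := s.monoG (Fin.succ_lt_succ_iff.mpr hij)
      rw [Fin.lt_def] at this
      omega)
    admissible := fun p hp => by
      obtain ⟨h, h1⟩ := (Finset.mem_filter.mp hp).2
      have h2 : s.key (Tuple.sort s.key p) < s.key (Tuple.sort s.key ⟨p + 1, h⟩) :=
        hmono (Fin.lt_def.mpr (Nat.lt_succ_self _))
      refine ⟨h, (s.key_even _).mp (by omega), ?_⟩
      have := (s.key_even (Tuple.sort s.key ⟨p + 1, h⟩)).not.mp (by omega)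
      omega }

theorem key_mono (s : Stuffle m n) : StrictMono fun p => s.key (s.toMixable.σ p) :=
  (Tuple.monotone_sort s.key).strictMono_of_injective (s.key_injective.comp (Equiv.injective _))

theorem exists_key (s : Stuffle m n) {j : ℕ} (h0 : j ≠ 0) (hj : j ≤ s.k) :
    ∃ p, s.key (s.toMixable.σ p) / 2 = j := by
  have hv : ((⟨j, by omega⟩ : Fin (s.k + 1)) : ℕ) = j := rfl
  suffices ∃ q, s.key q / 2 = j by
    obtain ⟨q, hq⟩ := this
    exact ⟨s.toMixable.σ.symm q, by rwa [Equiv.apply_symm_apply]⟩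
  rcases s.surj ⟨j, by omega⟩ with ⟨i, hi⟩ | ⟨i, hi⟩
  · induction i using Fin.cases with
    | zero => rw [s.F0] at hi; exact absurd (congrArg Fin.val hi).symm h0
    | succ i =>
      refine ⟨Fin.castAdd n i, ?_⟩
      rw [key_left, hi, hv]
      omega
  · induction i using Fin.cases with
    | zero => rw [s.G0] at hi; exact absurd (congrArg Fin.val hi).symm h0
    | succ i =>
      refine ⟨Fin.natAdd m i, ?_⟩
      rw [key_right, hi, hv]
      omega

theorem key_pos (s : Stuffle m n) (i : Fin (m + n)) : 1 ≤ s.key i / 2 := by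
  induction i using Fin.addCases with
  | left i =>
    have := s.monoF (Fin.succ_pos i)
    rw [key_left]
    rw [Fin.lt_def] at this
    omega
  | right i =>
    have := s.monoG (Fin.succ_pos i)
    rw [key_right]
    rw [Fin.lt_def] at this
    omega

theorem key_le (s : Stuffle m n) (i : Fin (m + n)) : s.key i / 2 ≤ s.k := by
  induction i using Fin.addCases with
  | left i =>
    have := (s.F i.succ).isLt
    rw [key_left]
    omega
  | right i =>
    have := (s.G i.succ).isLt
    rw [key_right]
    omega

theorem block_toMixable (s : Stuffle m n) (p : Fin (m + n)) :
    s.key (s.toMixable.σ p) / 2 = (s.toMixable.block p : ℕ) + 1 := by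
  have hle : ∀ {p q}, p ≤ q → s.key (s.toMixable.σ p) / 2 ≤ s.key (s.toMixable.σ q) / 2 :=
    fun h => Nat.div_le_div_right (s.key_mono.monotone h)
  obtain ⟨p, hp⟩ := p
  induction p with
  | zero =>
    rw [s.toMixable.block_zero]
    have h1 : 1 ≤ s.k := (s.key_pos _).trans (s.key_le (s.toMixable.σ ⟨0, hp⟩))
    obtain ⟨q, hq⟩ := s.exists_key one_ne_zero h1
    have := s.key_pos (s.toMixable.σ ⟨0, hp⟩)
    have := hle (Fin.le_def.mpr (Nat.zero_le q) : (⟨0, hp⟩ : Fin (m + n)) ≤ q)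
    omega
  | succ p ih =>
    have ih := ih (by omega)
    have h1 := s.toMixable.block_succ ⟨p, by omega⟩ hp
    dsimp only at h1
    have h2 : (⟨p, by omega⟩ : Fin (m + n)) ∈ s.toMixable.T ↔
        s.key (s.toMixable.σ ⟨p, by omega⟩) / 2 = s.key (s.toMixable.σ ⟨p + 1, hp⟩) / 2 := by
      refine ⟨fun h => ?_, fun h => ?_⟩
      · exact (Finset.mem_filter.mp h).2.2
      · exact Finset.mem_filter.mpr ⟨Finset.mem_univ _, hp, h⟩
    rw [h1]
    split_ifs with h3
    · rw [h2] at h3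
      omega
    · rw [h2] at h3
      have h4 := hle (Fin.le_def.mpr (Nat.le_succ p) :
        (⟨p, by omega⟩ : Fin (m + n)) ≤ ⟨p + 1, hp⟩)
      have h5 := s.key_le (s.toMixable.σ ⟨p + 1, hp⟩)
      obtain ⟨q, hq⟩ := s.exists_key
        (j := s.key (s.toMixable.σ ⟨p, by omega⟩) / 2 + 1) (by omega) (by omega)
      have h6 : (⟨p + 1, hp⟩ : Fin (m + n)) ≤ q := by
        by_contra h7
        have := hle (show q ≤ (⟨p, by omega⟩ : Fin (m + n)) by
          rw [Fin.le_def] at h7 ⊢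
          dsimp only at h7 ⊢
          omega)
        omega
      have := hle h6
      omega

theorem toStuffle_toMixable (s : Stuffle m n) : s.toMixable.toStuffle = s := by
  refine ext_val (fun i => ?_) fun i => ?_
  · induction i using Fin.cases with
    | zero => simp [s.F0, s.toMixable.toStuffle.F0]
    | succ i =>
      have h := s.block_toMixable (s.toMixable.σ.symm (Fin.castAdd n i))
      rw [Equiv.apply_symm_apply, key_left] at h
      change ((s.toMixable.block (s.toMixable.σ.symm (Fin.castAdd n i))).succ : ℕ) = _
      rw [Fin.val_succ]
      omega
  · induction i using Fin.cases with
    | zero => simp [s.G0, s.toMixable.toStuffle.G0]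
    | succ i =>
      have h := s.block_toMixable (s.toMixable.σ.symm (Fin.natAdd m i))
      rw [Equiv.apply_symm_apply, key_right] at h
      change ((s.toMixable.block (s.toMixable.σ.symm (Fin.natAdd m i))).succ : ℕ) = _
      rw [Fin.val_succ]
      omega

end Stuffle

/-- Mixable shuffles correspond to pairs of increasing maps. -/
def MixableShuffle.equivStuffle (m n : ℕ) : MixableShuffle m n ≃ Stuffle m n where
  toFun := toStuffle
  invFun := Stuffle.toMixable
  left_inv s := toStuffle_injective s.toStuffle.toStuffle_toMixable
  right_inv := Stuffle.toStuffle_toMixable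

noncomputable instance (m n : ℕ) : Fintype (Stuffle m n) :=
  Fintype.ofEquiv _ (MixableShuffle.equivStuffle m n)

theorem MixableShuffle.card_T_le {m n : ℕ} (s : MixableShuffle m n) : s.T.card ≤ m + n :=
  (Finset.card_le_univ _).trans (by simp)

/-- A triple of increasing maps that are jointly surjective and respect the leading positions. -/
structure Stuffle3 (m n p : ℕ) where
  k : ℕ
  F : Fin (m + 1) → Fin (k + 1)
  G : Fin (n + 1) → Fin (k + 1)
  H : Fin (p + 1) → Fin (k + 1)
  monoF : StrictMono F
  monoG : StrictMono G
  monoH : StrictMono H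
  F0 : F 0 = 0
  G0 : G 0 = 0
  H0 : H 0 = 0
  surj : ∀ j, (∃ i, F i = j) ∨ (∃ i, G i = j) ∨ ∃ i, H i = j

namespace Stuffle3

variable {m n p : ℕ}

/-- Cyclic exchange of the three maps. -/
def rotate (s : Stuffle3 m n p) : Stuffle3 n p m :=
  ⟨s.k, s.G, s.H, s.F, s.monoG, s.monoH, s.monoF, s.G0, s.H0, s.F0, fun j => by
    have := s.surj j
    tauto⟩

/-- The triple of a pair of pairs. -/
def comp (a : Σ s : Stuffle m n, Stuffle s.k p) : Stuffle3 m n p where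
  k := a.2.k
  F := a.2.F ∘ a.1.F
  G := a.2.F ∘ a.1.G
  H := a.2.G
  monoF := a.2.monoF.comp a.1.monoF
  monoG := a.2.monoF.comp a.1.monoG
  monoH := a.2.monoG
  F0 := by simp [a.1.F0, a.2.F0]
  G0 := by simp [a.1.G0, a.2.F0]
  H0 := a.2.G0
  surj := by
    intro j
    rcases a.2.surj j with ⟨i, rfl⟩ | h
    · rcases a.1.surj i with ⟨i, rfl⟩ | ⟨i, rfl⟩
      · exact Or.inl ⟨i, rfl⟩
      · exact Or.inr (Or.inl ⟨i, rfl⟩)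
    · exact Or.inr (Or.inr h)

theorem comp_injective :
    Function.Injective (comp : (Σ s : Stuffle m n, Stuffle s.k p) → Stuffle3 m n p) := by
  rintro ⟨s, t⟩ ⟨s', t'⟩ h
  simp only [comp, Stuffle3.mk.injEq] at h
  obtain ⟨k, F, G, mF, mG, F0, G0, sj⟩ := s
  obtain ⟨k', F', G', mF', mG', F0', G0', sj'⟩ := s'
  obtain ⟨l, H, E, mH, mE, H0, E0, st⟩ := t
  obtain ⟨l', H', E', mH', mE', H0', E0', st'⟩ := t'
  dsimp only at *
  obtain ⟨rfl, h1, h2, h3⟩ := h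
  have h1 := eq_of_heq h1
  have h2 := eq_of_heq h2
  obtain rfl := eq_of_heq h3
  have hr : Set.range H = Set.range H' := by
    ext j
    constructor
    · rintro ⟨i, rfl⟩
      rcases sj i with ⟨i, rfl⟩ | ⟨i, rfl⟩
      · exact ⟨F' i, (congrFun h1 i).symm⟩
      · exact ⟨G' i, (congrFun h2 i).symm⟩
    · rintro ⟨i, rfl⟩
      rcases sj' i with ⟨i, rfl⟩ | ⟨i, rfl⟩
      · exact ⟨F i, congrFun h1 i⟩
      · exact ⟨G i, congrFun h2 i⟩
  obtain rfl : k = k' := by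
    have h4 : (Set.range H).ncard = k + 1 := by
      rw [Set.ncard_range_of_injective mH.injective]; simp
    have h5 : (Set.range H').ncard = k' + 1 := by
      rw [Set.ncard_range_of_injective mH'.injective]; simp
    rw [hr, h5] at h4
    omega
  obtain rfl : H = H' := (StrictMono.range_inj mH mH').mp hr
  obtain rfl : F = F' := mH.injective.comp_left h1
  obtain rfl : G = G' := mH.injective.comp_left h2
  rfl

theorem comp_surjective :
    Function.Surjective (comp : (Σ s : Stuffle m n, Stuffle s.k p) → Stuffle3 m n p) := by
  rintro ⟨l, F, G, E, mF, mG, mE, F0, G0, E0, sj⟩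
  set S : Finset (Fin (l + 1)) := Finset.univ.image F ∪ Finset.univ.image G with hS
  have hF : ∀ i, F i ∈ S := fun i => by simp [hS]
  have hG : ∀ i, G i ∈ S := fun i => by simp [hS]
  have hpos : 0 < S.card := Finset.card_pos.mpr ⟨_, hF 0⟩
  obtain ⟨k, hk⟩ : ∃ k, S.card = k + 1 := ⟨S.card - 1, by omega⟩
  set H : Fin (k + 1) ↪o Fin (l + 1) := S.orderEmbOfFin hk with hH
  have hr : ∀ j, j ∈ S ↔ ∃ i, H i = j := fun j => by
    rw [← Finset.mem_coe, ← Finset.range_orderEmbOfFin S hk]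
    rfl
  choose F' hF' using fun i => (hr _).mp (hF i)
  choose G' hG' using fun i => (hr _).mp (hG i)
  have H0 : H 0 = 0 := by
    have h : H 0 ≤ H (F' 0) := H.monotone (Fin.zero_le _)
    rw [hF', F0] at h
    exact Fin.le_zero_iff.mp h
  refine ⟨⟨⟨k, F', G', fun a b h => ?_, fun a b h => ?_, ?_, ?_, fun j => ?_⟩,
    ⟨l, H, E, H.strictMono, mE, H0, E0, fun j => ?_⟩⟩, ?_⟩
  · rw [← H.lt_iff_lt, hF', hF']; exact mF h
  · rw [← H.lt_iff_lt, hG', hG']; exact mG h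
  · exact H.injective (by rw [hF', F0, H0])
  · exact H.injective (by rw [hG', G0, H0])
  · have h := (hr (H j)).mpr ⟨j, rfl⟩
    simp only [hS, Finset.mem_union, Finset.mem_image, Finset.mem_univ, true_and] at h
    rcases h with ⟨i, hi⟩ | ⟨i, hi⟩
    · exact Or.inl ⟨i, H.injective (by rw [hF', hi])⟩
    · exact Or.inr ⟨i, H.injective (by rw [hG', hi])⟩
  · rcases sj j with ⟨i, rfl⟩ | ⟨i, rfl⟩ | h
    · exact Or.inl ⟨F' i, hF' i⟩
    · exact Or.inl ⟨G' i, hG' i⟩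
    · exact Or.inr h
  · simp only [comp, Stuffle3.mk.injEq, heq_eq_eq, true_and]
    exact ⟨funext hF', funext hG', trivial⟩

/-- Triples of increasing maps correspond to pairs of pairs. -/
noncomputable def compEquiv (m n p : ℕ) :
    (Σ s : Stuffle m n, Stuffle s.k p) ≃ Stuffle3 m n p :=
  Equiv.ofBijective comp ⟨comp_injective, comp_surjective⟩

noncomputable instance : Fintype (Stuffle3 m n p) := Fintype.ofEquiv _ (compEquiv m n p)

/-- Cyclic exchange is a bijection. -/
def rotateEquiv (m n p : ℕ) : Stuffle3 m n p ≃ Stuffle3 n p m where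
  toFun := rotate
  invFun s := s.rotate.rotate
  left_inv _ := rfl
  right_inv _ := rfl

end Stuffle3

/-! ### The shuffle Baxter algebra -/

universe u v

/-- The module `⨁_{k ≥ 0} A^{⊗ (k + 1)}` that underlies the shuffle Baxter algebra of weight `lam`
on `A`. The weight enters through the multiplication. -/
def Sha (C : Type u) [CommRing C] (_lam : C) (A : Type v) [CommRing A] [Algebra C A] :
    Type (max u v) :=
  ⨁ k : ℕ, ⨂[C]^(k + 1) A

namespace Sha

variable {C : Type u} [CommRing C] {lam : C} {A : Type v} [CommRing A] [Algebra C A]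

noncomputable instance : AddCommGroup (Sha C lam A) :=
  inferInstanceAs (AddCommGroup (⨁ k : ℕ, ⨂[C]^(k + 1) A))

noncomputable instance : Module C (Sha C lam A) :=
  inferInstanceAs (Module C (⨁ k : ℕ, ⨂[C]^(k + 1) A))

/-- The inclusion of `A^{⊗ (k + 1)}`. -/
noncomputable def incl (C : Type u) [CommRing C] (lam : C) (A : Type v) [CommRing A] [Algebra C A]
    (k : ℕ) : (⨂[C]^(k + 1) A) →ₗ[C] Sha C lam A :=
  DirectSum.lof C ℕ (fun k => ⨂[C]^(k + 1) A) k

/-- The linear map with given components on the summands `A^{⊗ (k + 1)}`. -/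
noncomputable def ofComponents {N : Type*} [AddCommGroup N] [Module C N]
    (f : ∀ k : ℕ, (⨂[C]^(k + 1) A) →ₗ[C] N) : Sha C lam A →ₗ[C] N :=
  DirectSum.toModule C ℕ N f

theorem ofComponents_incl {N : Type*} [AddCommGroup N] [Module C N]
    (f : ∀ k : ℕ, (⨂[C]^(k + 1) A) →ₗ[C] N) (k : ℕ) (x : ⨂[C]^(k + 1) A) :
    ofComponents f (incl C lam A k x) = f k x :=
  DirectSum.toModule_lof (φ := f) C k x

/-- The pure tensor `x₀ ⊗ x₁ ⊗ … ⊗ xₖ`. -/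
noncomputable def pure (C : Type u) [CommRing C] (lam : C) {A : Type v} [CommRing A] [Algebra C A]
    {k : ℕ} (x : Fin (k + 1) → A) : Sha C lam A :=
  incl C lam A k (PiTensorProduct.tprod C x)

theorem induction {motive : Sha C lam A → Prop} (x : Sha C lam A)
    (hpure : ∀ (k : ℕ) (x : Fin (k + 1) → A), motive (pure C lam x))
    (hsmul : ∀ (c : C) (x : Sha C lam A), motive x → motive (c • x))
    (hadd : ∀ x y : Sha C lam A, motive x → motive y → motive (x + y)) : motive x := by
  have h0 : motive 0 := by
    simpa using hsmul 0 _ (hpure 0 0)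
  refine DirectSum.induction_on (motive := motive) x h0 (fun k z => ?_) hadd
  change motive (incl C lam A k z)
  refine PiTensorProduct.induction_on z (fun c f => ?_) fun a b ha hb => ?_
  · rw [map_smul]
    exact hsmul c _ (hpure k f)
  · rw [map_add]
    exact hadd _ _ ha hb

/-- The `C`-multilinear map that sends `x₀, …, xₘ, y₀, …, yₙ` to the pure tensor with the factors
`s.word x y`. -/
noncomputable def wordTensor (C : Type u) [CommRing C] (A : Type v) [CommRing A] [Algebra C A]
    {m n : ℕ} (s : MixableShuffle m n) :
    MultilinearMap C (fun _ : Fin (m + 1) ⊕ Fin (n + 1) => A)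
      (⨂[C]^(m + n - s.T.card + 1) A) where
  toFun u := PiTensorProduct.tprod C (s.word (u ∘ Sum.inl) (u ∘ Sum.inr))
  map_update_add' u i a b := by
    simp only [s.word_eq, ← push_sumElim, push_update, add_mul, MultilinearMap.map_update_add]
  map_update_smul' u i c a := by
    simp only [s.word_eq, ← push_sumElim, push_update, smul_mul_assoc,
      MultilinearMap.map_update_smul]

/-- The mixed shuffle product on `A^{⊗ (m + 1)} × A^{⊗ (n + 1)}`. -/
noncomputable def mulComp (C : Type u) [CommRing C] (lam : C) (A : Type v) [CommRing A]
    [Algebra C A] (m n : ℕ) :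
    (⨂[C]^(m + 1) A) →ₗ[C] (⨂[C]^(n + 1) A) →ₗ[C] Sha C lam A :=
  PiTensorProduct.lift
    (PiTensorProduct.lift.toLinearMap.compMultilinearMap
      (∑ s : MixableShuffle m n, lam ^ s.T.card •
        (incl C lam A _).compMultilinearMap (wordTensor C A s)).currySum)

/-- The mixed shuffle product as a bilinear map. -/
noncomputable def mulHom (C : Type u) [CommRing C] (lam : C) (A : Type v) [CommRing A]
    [Algebra C A] : Sha C lam A →ₗ[C] Sha C lam A →ₗ[C] Sha C lam A :=
  ofComponents fun m => (ofComponents fun n => (mulComp C lam A m n).flip).flip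

theorem mulHom_incl {m n : ℕ} (x : ⨂[C]^(m + 1) A) (y : ⨂[C]^(n + 1) A) :
    mulHom C lam A (incl C lam A m x) (incl C lam A n y) = mulComp C lam A m n x y := by
  rw [mulHom, ofComponents_incl, LinearMap.flip_apply, ofComponents_incl, LinearMap.flip_apply]

noncomputable instance : Mul (Sha C lam A) := ⟨fun x y => mulHom C lam A x y⟩

noncomputable instance : One (Sha C lam A) := ⟨pure C lam (k := 0) fun _ => 1⟩

theorem mul_def (x y : Sha C lam A) : x * y = mulHom C lam A x y := rfl

theorem one_def : (1 : Sha C lam A) = pure C lam (k := 0) fun _ => 1 := rfl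

/-- The formula for the mixed shuffle product:
`x y = ∑_{(σ, T)} lam ^ |T| • x₀ y₀ ⊗ σ (x⁺ ⊗ y⁺; T)`. -/
theorem pure_mul_pure {m n : ℕ} (x : Fin (m + 1) → A) (y : Fin (n + 1) → A) :
    (pure C lam x * pure C lam y : Sha C lam A) =
      ∑ s : MixableShuffle m n, lam ^ s.T.card • pure C lam (s.word x y) := by
  rw [mul_def, pure, pure, mulHom_incl]
  simp only [mulComp, PiTensorProduct.lift.tprod, LinearMap.compMultilinearMap_apply,
    LinearEquiv.coe_coe, MultilinearMap.currySum_apply', sum_apply, smul_apply]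
  rfl

/-- The formula for the product in terms of pairs of increasing maps. -/
theorem pure_mul_pure_stuffle {m n : ℕ} (x : Fin (m + 1) → A) (y : Fin (n + 1) → A) :
    (pure C lam x * pure C lam y : Sha C lam A) =
      ∑ s : Stuffle m n, lam ^ (m + n - s.k) • pure C lam (push s.F x * push s.G y) := by
  rw [pure_mul_pure, ← (MixableShuffle.equivStuffle m n).sum_comp]
  refine Finset.sum_congr rfl fun s _ => ?_
  have h := s.card_T_le
  have h1 : m + n - (MixableShuffle.equivStuffle m n s).k = s.T.card := by
    change m + n - (m + n - s.T.card) = _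
    omega
  rw [h1, s.word_eq]
  rfl

protected theorem add_mul (x y z : Sha C lam A) : (x + y) * z = x * z + y * z := by
  simp [mul_def]

protected theorem mul_add (x y z : Sha C lam A) : x * (y + z) = x * y + x * z := by
  simp [mul_def]

protected theorem smul_mul (c : C) (x y : Sha C lam A) : (c • x) * y = c • (x * y) := by
  simp [mul_def]

protected theorem mul_smul (c : C) (x y : Sha C lam A) : x * (c • y) = c • (x * y) := by
  simp [mul_def]

protected theorem sum_mul {ι : Type*} (s : Finset ι) (f : ι → Sha C lam A) (y : Sha C lam A) :
    (∑ i ∈ s, f i) * y = ∑ i ∈ s, f i * y := by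
  simp [mul_def]

protected theorem mul_comm (x y : Sha C lam A) : x * y = y * x := by
  induction x using Sha.induction with
  | hsmul c x hx => rw [Sha.smul_mul, Sha.mul_smul, hx]
  | hadd x x' hx hx' => rw [Sha.add_mul, Sha.mul_add, hx, hx']
  | hpure m x =>
    induction y using Sha.induction with
    | hsmul c y hy => rw [Sha.smul_mul, Sha.mul_smul, hy]
    | hadd y y' hy hy' => rw [Sha.add_mul, Sha.mul_add, hy, hy']
    | hpure n y =>
      rw [pure_mul_pure_stuffle, pure_mul_pure_stuffle]
      refine Fintype.sum_equiv (⟨Stuffle.swap, Stuffle.swap, fun _ => rfl, fun _ => rfl⟩ :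
        Stuffle m n ≃ Stuffle n m) _ _ fun s => ?_
      change _ = (lam ^ (n + m - s.k) • pure C lam (push s.G y * push s.F x) : Sha C lam A)
      rw [add_comm n m, mul_comm (push s.G y)]

theorem pure_mul_pure_mul_pure {m n p : ℕ} (x : Fin (m + 1) → A) (y : Fin (n + 1) → A)
    (z : Fin (p + 1) → A) :
    (pure C lam x * pure C lam y * pure C lam z : Sha C lam A) =
      ∑ s : Stuffle3 m n p,
        lam ^ (m + n + p - s.k) • pure C lam (push s.F x * push s.G y * push s.H z) := by
  rw [pure_mul_pure_stuffle, Sha.sum_mul, ← (Stuffle3.compEquiv m n p).sum_comp,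
    Fintype.sum_sigma]
  refine Finset.sum_congr rfl fun s _ => ?_
  rw [Sha.smul_mul, pure_mul_pure_stuffle, Finset.smul_sum]
  refine Finset.sum_congr rfl fun t _ => ?_
  have h1 := s.k_le
  have h2 := t.k_le
  rw [smul_smul, ← pow_add, push_mul, push_push, push_push]
  change _ = lam ^ (m + n + p - t.k) • _
  rw [show m + n - s.k + (s.k + p - t.k) = m + n + p - t.k by omega]
  rfl

protected theorem mul_assoc (x y z : Sha C lam A) : x * y * z = x * (y * z) := by
  rw [Sha.mul_comm x (y * z)]
  induction x using Sha.induction with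
  | hsmul c x hx => simp only [Sha.smul_mul, Sha.mul_smul, hx]
  | hadd x x' hx hx' => simp only [Sha.add_mul, Sha.mul_add, hx, hx']
  | hpure m x =>
    induction y using Sha.induction with
    | hsmul c y hy => simp only [Sha.smul_mul, Sha.mul_smul, hy]
    | hadd y y' hy hy' => simp only [Sha.add_mul, Sha.mul_add, hy, hy']
    | hpure n y =>
      induction z using Sha.induction with
      | hsmul c z hz => simp only [Sha.smul_mul, Sha.mul_smul, hz]
      | hadd z z' hz hz' => simp only [Sha.add_mul, Sha.mul_add, hz, hz']
      | hpure p z =>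
        rw [pure_mul_pure_mul_pure, pure_mul_pure_mul_pure]
        refine Fintype.sum_equiv (Stuffle3.rotateEquiv m n p) _ _ fun s => ?_
        change _ = (lam ^ (n + p + m - s.k) •
          pure C lam (push s.G y * push s.H z * push s.F x) : Sha C lam A)
        rw [show n + p + m = m + n + p by omega, mul_assoc, mul_comm (push s.F x)]

protected theorem one_mul (x : Sha C lam A) : 1 * x = x := by
  induction x using Sha.induction with
  | hsmul c x hx => rw [Sha.mul_smul, hx]
  | hadd x x' hx hx' => rw [Sha.mul_add, hx, hx']
  | hpure n x =>
    have hsub : ∀ i : Fin (0 + 1), i = 0 := fun i => Fin.ext (by omega)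
    have h0 : ∀ {k : ℕ} (f : Fin (0 + 1) → Fin k), StrictMono f := fun f a b hab =>
      absurd hab (by rw [hsub a, hsub b]; exact lt_irrefl _)
    let e : Stuffle 0 n := ⟨n, fun _ => 0, fun i => i, h0 _, strictMono_id,
      rfl, rfl, fun j => Or.inr ⟨j, rfl⟩⟩
    have he : ∀ s : Stuffle 0 n, s = e := by
      rintro ⟨k, F, G, mF, mG, F0, G0, sj⟩
      have hs : Function.Surjective G := fun j => by
        rcases sj j with ⟨i, rfl⟩ | h
        · exact ⟨0, by rw [hsub i, F0, G0]⟩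
        · exact h
      have hk := Fintype.card_of_bijective ⟨mG.injective, hs⟩
      simp only [Fintype.card_fin, Nat.add_right_cancel_iff] at hk
      subst hk
      obtain rfl : G = fun i => i := by
        refine (StrictMono.range_inj mG strictMono_id).mp ?_
        rw [hs.range_eq, Set.range_id]
      obtain rfl : F = fun _ => 0 := funext fun i => by rw [hsub i, F0]
      rfl
    rw [one_def, pure_mul_pure_stuffle, Fintype.sum_eq_single e fun s hs => absurd (he s) hs]
    have h1 : push e.F (fun _ => (1 : A)) = 1 := push_one _
    have h2 : push e.G x = x := push_id x
    rw [h1, h2, one_mul]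
    simp [e]

/-- The shuffle Baxter algebra is a commutative ring. -/
noncomputable instance : CommRing (Sha C lam A) where
  __ := (inferInstance : AddCommGroup (Sha C lam A))
  left_distrib := Sha.mul_add
  right_distrib := Sha.add_mul
  zero_mul x := by simp [mul_def]
  mul_zero x := by simp [mul_def]
  mul_assoc := Sha.mul_assoc
  one_mul := Sha.one_mul
  mul_one x := by rw [Sha.mul_comm, Sha.one_mul]
  mul_comm := Sha.mul_comm

noncomputable instance : Algebra C (Sha C lam A) :=
  Algebra.ofModule Sha.smul_mul Sha.mul_smul

/-- The Baxter operator `x₀ ⊗ … ⊗ xₖ ↦ 1 ⊗ x₀ ⊗ … ⊗ xₖ`. -/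
noncomputable def P (C : Type u) [CommRing C] (lam : C) (A : Type v) [CommRing A] [Algebra C A] :
    Sha C lam A →ₗ[C] Sha C lam A :=
  ofComponents fun k => incl C lam A (k + 1) ∘ₗ
    PiTensorProduct.lift
      ((PiTensorProduct.tprod C : MultilinearMap C (fun _ : Fin (k + 1 + 1) => A) _).curryLeft 1)

theorem P_pure {k : ℕ} (x : Fin (k + 1) → A) :
    P C lam A (pure C lam x) = pure C lam (k := k + 1) (Fin.cons 1 x) := by
  rw [P, pure, ofComponents_incl, LinearMap.comp_apply, PiTensorProduct.lift.tprod,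
    MultilinearMap.curryLeft_apply, pure]

/-- The canonical inclusion of `A` as the summand `A^{⊗ 1}`. -/
noncomputable def j (C : Type u) [CommRing C] (lam : C) {A : Type v} [CommRing A] [Algebra C A]
    (a : A) : Sha C lam A :=
  pure C lam (k := 0) fun _ => a

end Sha

/-! ### Baxter ideals and torsion -/

/-- A Baxter ideal of `(R, P)` is an ideal that is stable under `P`. -/
def IsBaxterIdeal {R : Type*} [CommRing R] (P : R → R) (J : Ideal R) : Prop :=
  ∀ x ∈ J, P x ∈ J

/-- The Baxter ideal of `(R, P)` generated by a set `S`: the smallest Baxter ideal that contains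
`S`. -/
def baxterIdealSpan {R : Type*} [CommRing R] (P : R → R) (S : Set R) : Ideal R :=
  sInf {J : Ideal R | IsBaxterIdeal P J ∧ S ⊆ J}

theorem isBaxterIdeal_baxterIdealSpan {R : Type*} [CommRing R] (P : R → R) (S : Set R) :
    IsBaxterIdeal P (baxterIdealSpan P S) := by
  intro x hx
  rw [baxterIdealSpan, Submodule.mem_sInf] at hx ⊢
  exact fun J hJ => hJ.1 x (hx J hJ)

theorem subset_baxterIdealSpan {R : Type*} [CommRing R] (P : R → R) (S : Set R) :
    S ⊆ baxterIdealSpan P S := by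
  intro x hx
  rw [SetLike.mem_coe, baxterIdealSpan, Submodule.mem_sInf]
  exact fun J hJ => hJ.2 hx

/-- The torsion of a `C`-module `N` relative to an ideal `K` of `C`: the elements that are
annihilated by some `r ∈ C` with `r ∉ K`. For `K = 0` these are the elements annihilated by some
nonzero `r`. If `K` annihilates `N`, they are the `C ⧸ K`-torsion elements of the
`C ⧸ K`-module `N`. -/
def torsionModulo {C : Type*} [CommRing C] (K : Ideal C) (N : Type*) [AddCommGroup N]
    [Module C N] : Set N :=
  {x | ∃ r : C, r ∉ K ∧ r • x = 0}

end BaxterAlgebra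

/-! The homomorphism `Sha A → Sha (A ⧸ I)` of Baxter algebras is surjective with kernel `Ĩ`, so the
question is when `Sha B` is a domain, for `B = A ⧸ I`.

In a product of elements of degrees `m` and `n`, the part of degree `m + n` is their plain shuffle
product, whatever the weight. If the tensor powers of `B` have no torsion, tensors are detected by
coordinates with values in the fraction field of `B`. The shuffles of two words then yield a largest
word, with a positive multiplicity, so in characteristic zero the top-degree part of a product of
nonzero elements is nonzero.

Conversely, `n! • (1 ⊗ ⋯ ⊗ 1)` is a product of nonzero factors `1 ⊗ 1 - r` with `r ∈ C`, so if
`Sha B` is a domain then `n! ≠ 0` in `B`; and `r • x = (r • 1) * x` excludes torsion. -/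

namespace BaxterAlgebra

section push

variable {ι κ A B : Type*} [Fintype ι] [DecidableEq κ] [CommRing A] [CommRing B]

theorem push_apply_of_injective {F : ι → κ} (hF : Function.Injective F) (x : ι → A) (i : ι) :
    push F x (F i) = x i := by
  classical
  refine Finset.prod_eq_single i (fun i' hi' hne => ?_) fun h => ?_
  · exact absurd (hF (Finset.mem_filter.mp hi').2) hne
  · simp only [Finset.mem_filter_univ, not_true_eq_false] at h

theorem push_apply_of_notMem_range {F : ι → κ} (x : ι → A) {j : κ} (hj : j ∉ Set.range F) :
    push F x j = 1 := by
  rw [push, Finset.filter_false_of_mem fun i _ hi => hj ⟨i, hi⟩, Finset.prod_empty]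

theorem map_push {G : Type*} [FunLike G A B] [MonoidHomClass G A B] (f : G) (F : ι → κ)
    (x : ι → A) : f ∘ push F x = push F (f ∘ x) :=
  funext fun _ => map_prod f _ _

end push

namespace Stuffle

variable {n : ℕ}

/-- The only stuffle of words of lengths `1` and `n + 1`. -/
def ofRight (n : ℕ) : Stuffle 0 n :=
  ⟨n, fun _ => 0, fun i => i, Subsingleton.strictMono (α := Fin 1) _, strictMono_id, rfl, rfl,
    fun j => Or.inr ⟨j, rfl⟩⟩

theorem eq_ofRight (s : Stuffle 0 n) : s = ofRight n := by
  have hF : ∀ i, s.F i = 0 := fun i => by rw [Subsingleton.elim (α := Fin 1) i 0, s.F0]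
  have hG : Function.Surjective s.G := fun j =>
    (s.surj j).elim (fun ⟨i, hi⟩ => ⟨0, by rw [s.G0, ← hi, hF]⟩) id
  let e : Fin (n + 1) ≃o Fin (s.k + 1) := s.monoG.orderIsoOfSurjective _ hG
  refine ext_val (fun i => by rw [hF]; rfl) fun i => ?_
  exact Fin.coe_orderIso_apply e i

end Stuffle

namespace Sha

variable {C : Type*} [CommRing C] {lam : C} {A : Type*} [CommRing A] [Algebra C A]

theorem j_mul_pure (a : A) {n : ℕ} (x : Fin (n + 1) → A) :
    j C lam a * pure C lam x = pure C lam (Function.update x 0 (a * x 0)) := by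
  let F : Fin (0 + 1) → Fin (n + 1) := fun _ => 0
  have hF : push F (fun _ => a) * push (fun i => i) x = Function.update x 0 (a * x 0) := by
    have hinj : Function.Injective F := Function.injective_of_subsingleton (α := Fin 1) F
    funext i
    rw [push_id, Pi.mul_apply]
    rcases eq_or_ne i 0 with rfl | hi
    · rw [Function.update_self]
      exact congrArg (· * x 0) (push_apply_of_injective hinj (fun _ => a) 0)
    · rw [Function.update_of_ne hi, push_apply_of_notMem_range, one_mul]
      rintro ⟨_, rfl⟩
      exact hi rfl
  rw [j, pure_mul_pure_stuffle,
    Fintype.sum_eq_single (Stuffle.ofRight n) fun s hs => absurd s.eq_ofRight hs]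
  change lam ^ (0 + n - n) • pure C lam (k := n) (push F (fun _ => a) * push (fun i => i) x) = _
  rw [hF, zero_add, Nat.sub_self, pow_zero, one_smul]

theorem pure_cons (a : A) {n : ℕ} (x : Fin (n + 1) → A) :
    pure C lam (k := n + 1) (Fin.cons a x) = j C lam a * P C lam A (pure C lam x) := by
  rw [P_pure, j_mul_pure, Fin.cons_zero, mul_one, Fin.update_cons_zero]

theorem pure_eq_j (x : Fin (0 + 1) → A) : pure C lam x = j C lam (x 0) :=
  congrArg (pure C lam) (funext fun i => congrArg x (Subsingleton.elim (α := Fin 1) i 0))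

theorem j_eq_incl (a : A) :
    j C lam a = incl C lam A 0
      ((PiTensorProduct.subsingletonEquiv (0 : Fin 1)).symm a : ⨂[C]^1 A) :=
  congrArg (incl C lam A 0) (PiTensorProduct.subsingletonEquiv_symm_apply' (0 : Fin 1) a).symm

/-- The inclusion `A → A^{⊗ 1}` into the shuffle Baxter algebra, as an algebra homomorphism. -/
noncomputable def jHom (C : Type*) [CommRing C] (lam : C) (A : Type*) [CommRing A] [Algebra C A] :
    A →ₐ[C] Sha C lam A where
  toFun := j C lam
  map_one' := rfl
  map_mul' a b := by rw [← pure_eq_j fun _ => b, j_mul_pure, pure_eq_j, Function.update_self]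
  map_zero' := by rw [j_eq_incl, map_zero, map_zero]
  map_add' a b := by simp only [j_eq_incl, map_add]
  commutes' c := by
    simp only [Algebra.algebraMap_eq_smul_one, one_def, j_eq_incl, map_smul]
    rw [← j_eq_incl, j]

theorem jHom_apply (a : A) : jHom C lam A a = j C lam a := rfl

theorem linearMap_ext {N : Type*} [AddCommGroup N] [Module C N] {f g : Sha C lam A →ₗ[C] N}
    (hj : ∀ a, f (j C lam a) = g (j C lam a))
    (hP : ∀ a x, f x = g x → f (j C lam a * P C lam A x) = g (j C lam a * P C lam A x)) :
    f = g := by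
  ext x
  induction x using Sha.induction with
  | hsmul c x hx => rw [map_smul, map_smul, hx]
  | hadd x y hx hy => rw [map_add, map_add, hx, hy]
  | hpure k x =>
    induction k with
    | zero => rw [pure_eq_j, hj]
    | succ k ih =>
      rw [← Fin.cons_self_tail x, pure_cons]
      exact hP _ _ (ih _)

section lift

variable {R : Type*} [CommRing R] [Algebra C R] (f : A →ₗ[C] R) (Q : R →ₗ[C] R)

/-- The multilinear map `(x₀, …, xₖ) ↦ f x₀ * Q (f x₁ * Q (… * Q (f xₖ)))`. -/
noncomputable def liftMultilinear : ∀ k : ℕ, MultilinearMap C (fun _ : Fin (k + 1) => A) R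
  | 0 => MultilinearMap.ofSubsingleton C A R (0 : Fin 1) f
  | k + 1 => LinearMap.uncurryLeft
    { toFun a := (LinearMap.mulLeft C (f a) ∘ₗ Q).compMultilinearMap (liftMultilinear k)
      map_add' a b := by
        ext
        simp [add_mul]
      map_smul' c a := by
        ext
        simp }

/-- The linear map `x₀ ⊗ ⋯ ⊗ xₖ ↦ f x₀ * Q (f x₁ * Q (… * Q (f xₖ)))`: the only candidate for a
homomorphism of Baxter algebras that extends `f`. -/
noncomputable def liftLinear (lam : C) : Sha C lam A →ₗ[C] R :=
  ofComponents fun k => PiTensorProduct.lift (liftMultilinear f Q k)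

theorem liftLinear_pure {k : ℕ} (x : Fin (k + 1) → A) :
    liftLinear f Q lam (pure C lam x) = liftMultilinear f Q k x := by
  rw [liftLinear, pure, ofComponents_incl, PiTensorProduct.lift.tprod]

theorem liftLinear_j (a : A) : liftLinear f Q lam (j C lam a) = f a := by
  rw [j, liftLinear_pure]
  rfl

theorem liftLinear_j_mul_P (a : A) (x : Sha C lam A) :
    liftLinear f Q lam (j C lam a * P C lam A x) = f a * Q (liftLinear f Q lam x) := by
  induction x using Sha.induction with
  | hsmul c x hx => simp only [map_smul, hx, mul_smul_comm]
  | hadd x y hx hy => simp only [map_add, mul_add, hx, hy]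
  | hpure k x =>
    rw [← pure_cons, liftLinear_pure, liftLinear_pure]
    rfl

end lift

section map

variable {B : Type*} [CommRing B] [Algebra C B]

/-- The map of shuffle Baxter algebras induced by a linear map, applied to each tensor factor. -/
noncomputable def mapLinear (lam : C) (f : A →ₗ[C] B) : Sha C lam A →ₗ[C] Sha C lam B :=
  ofComponents fun k => incl C lam B k ∘ₗ PiTensorProduct.map fun _ => f

theorem mapLinear_pure (f : A →ₗ[C] B) {k : ℕ} (x : Fin (k + 1) → A) :
    mapLinear lam f (pure C lam x) = pure C lam (f ∘ x) := by
  rw [mapLinear, pure, ofComponents_incl, LinearMap.comp_apply, PiTensorProduct.map_tprod]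
  rfl

theorem mapLinear_mul (f : A →ₐ[C] B) (x y : Sha C lam A) :
    mapLinear lam f.toLinearMap (x * y) =
      mapLinear lam f.toLinearMap x * mapLinear lam f.toLinearMap y := by
  induction x using Sha.induction with
  | hsmul c x hx => simp only [smul_mul_assoc, map_smul, hx]
  | hadd x x' hx hx' => simp only [add_mul, map_add, hx, hx']
  | hpure m x =>
    induction y using Sha.induction with
    | hsmul c y hy => simp only [mul_smul_comm, map_smul, hy]
    | hadd y y' hy hy' => simp only [mul_add, map_add, hy, hy']
    | hpure n y =>
      simp only [pure_mul_pure_stuffle, map_sum, map_smul, mapLinear_pure, AlgHom.coe_toLinearMap,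
        ← map_push]
      refine Finset.sum_congr rfl fun s _ => congrArg (_ • pure C lam ·) ?_
      exact funext fun _ => map_mul f _ _

/-- The algebra homomorphism of shuffle Baxter algebras induced by an algebra homomorphism. -/
noncomputable def map (lam : C) (f : A →ₐ[C] B) : Sha C lam A →ₐ[C] Sha C lam B :=
  AlgHom.ofLinearMap (mapLinear lam f.toLinearMap)
    ((mapLinear_pure _ _).trans (congrArg (pure C lam) (funext fun _ => map_one f)))
    (mapLinear_mul f)

theorem map_pure (f : A →ₐ[C] B) {k : ℕ} (x : Fin (k + 1) → A) :
    map lam f (pure C lam x) = pure C lam (f ∘ x) :=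
  mapLinear_pure f.toLinearMap x

theorem map_j (f : A →ₐ[C] B) (a : A) : map lam f (j C lam a) = j C lam (f a) :=
  map_pure f _

theorem map_P (f : A →ₐ[C] B) (x : Sha C lam A) :
    map lam f (P C lam A x) = P C lam B (map lam f x) := by
  induction x using Sha.induction with
  | hsmul c x hx => simp only [map_smul, hx]
  | hadd x y hx hy => simp only [map_add, hx, hy]
  | hpure k x =>
    rw [P_pure, map_pure, map_pure, P_pure, ← map_one f]
    exact congrArg (pure C lam) (Fin.comp_cons f 1 x)

theorem map_surjective {f : A →ₐ[C] B} (hf : Function.Surjective f) :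
    Function.Surjective (map lam f) := by
  intro y
  induction y using Sha.induction with
  | hsmul c y hy =>
    obtain ⟨x, rfl⟩ := hy
    exact ⟨c • x, map_smul _ c x⟩
  | hadd y y' hy hy' =>
    obtain ⟨x, rfl⟩ := hy
    obtain ⟨x', rfl⟩ := hy'
    exact ⟨x + x', map_add _ x x'⟩
  | hpure k y =>
    obtain ⟨x, rfl⟩ := hf.comp_left y
    exact ⟨pure C lam x, map_pure f x⟩

theorem ker_map_mk (lam : C) (I : Ideal A) :
    RingHom.ker (map lam (Ideal.Quotient.mkₐ C I)) =
      baxterIdealSpan (P C lam A) (j C lam '' (I : Set A)) := by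
  set J := baxterIdealSpan (P C lam A) (j C lam '' (I : Set A))
  have hJ : IsBaxterIdeal (P C lam A) J := isBaxterIdeal_baxterIdealSpan _ _
  have hIJ : ∀ a ∈ I, j C lam a ∈ J := fun a ha => subset_baxterIdealSpan _ _ ⟨a, ha, rfl⟩
  let π := Ideal.Quotient.mkₐ C J
  refine le_antisymm (fun z hz => ?_) (sInf_le ⟨fun x hx => ?_, ?_⟩)
  · let f : A ⧸ I →ₐ[C] Sha C lam A ⧸ J :=
      Ideal.Quotient.liftₐ I (π.comp (jHom C lam A)) fun a ha =>
        Ideal.Quotient.eq_zero_iff_mem.mpr (hIJ a ha)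
    let Q : Sha C lam A ⧸ J →ₗ[C] Sha C lam A ⧸ J :=
      (J.restrictScalars C).liftQ (π.toLinearMap ∘ₗ P C lam A) fun x hx =>
        Ideal.Quotient.eq_zero_iff_mem.mpr (hJ x hx)
    have hfactor : liftLinear f.toLinearMap Q lam ∘ₗ (map lam (Ideal.Quotient.mkₐ C I)).toLinearMap
        = π.toLinearMap := by
      refine linearMap_ext (fun a => ?_) fun a x hx => ?_ <;>
        simp only [LinearMap.comp_apply, AlgHom.toLinearMap_apply] at *
      · rw [map_j, liftLinear_j]
        rfl
      · rw [map_mul, map_P, map_j, liftLinear_j_mul_P, hx, map_mul]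
        rfl
    have hz' : π z = 0 := by
      rw [← AlgHom.toLinearMap_apply, ← hfactor, LinearMap.comp_apply, AlgHom.toLinearMap_apply,
        (hz : map lam _ z = 0), map_zero]
    exact Ideal.Quotient.eq_zero_iff_mem.mp hz'
  · rw [RingHom.mem_ker, map_P, RingHom.mem_ker.mp hx, map_zero]
  · rintro _ ⟨a, ha, rfl⟩
    rw [SetLike.mem_coe, RingHom.mem_ker, map_j, ← jHom_apply, Ideal.Quotient.mkₐ_eq_mk,
      Ideal.Quotient.eq_zero_iff_mem.mpr ha, map_zero]

theorem isPrime_baxterIdealSpan_iff_isDomain (lam : C) (I : Ideal A) :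
    (baxterIdealSpan (P C lam A) (j C lam '' (I : Set A))).IsPrime ↔
      IsDomain (Sha C lam (A ⧸ I)) := by
  rw [← ker_map_mk, ← Ideal.Quotient.isDomain_iff_prime]
  exact (RingHom.quotientKerEquivOfSurjective
    (map_surjective (lam := lam) (Ideal.Quotient.mkₐ_surjective C I))).toMulEquiv.isDomain_iff

end map

end Sha

/-- A shuffle of a word of length `m` with a word of length `n`, encoded as the set of the positions
that the letters of the first word take in the shuffled word. -/
abbrev Shuffle (m n : ℕ) : Type :=
  {t : Finset (Fin (m + n)) // t.card = m}

namespace Shuffle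

variable {m n : ℕ} {ι : Type*} (t : Shuffle m n)

theorem card_shuffle (m n : ℕ) : Fintype.card (Shuffle m n) = (m + n).choose m := by
  rw [Fintype.card_finset_len, Fintype.card_fin]

theorem card_compl : (t.1ᶜ).card = n := by
  rw [Finset.card_compl, t.2, Fintype.card_fin, Nat.add_sub_cancel_left]

/-- The positions of the letters of the first word. -/
def left : Fin m ↪o Fin (m + n) := t.1.orderEmbOfFin t.2

/-- The positions of the letters of the second word. -/
def right : Fin n ↪o Fin (m + n) := (t.1ᶜ).orderEmbOfFin t.card_compl

/-- The positions of the letters of the two words. -/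
def position : Fin m ⊕ Fin n ≃ Fin (m + n) := finSumEquivOfFinset t.2 t.card_compl

theorem position_inl (i : Fin m) : t.position (.inl i) = t.left i := finSumEquivOfFinset_inl ..

theorem position_inr (i : Fin n) : t.position (.inr i) = t.right i := finSumEquivOfFinset_inr ..

theorem left_ne_right (i : Fin m) (j : Fin n) : t.left i ≠ t.right j := by
  rw [← position_inl, ← position_inr]
  exact t.position.injective.ne Sum.inl_ne_inr

theorem eq_left_or_eq_right (p : Fin (m + n)) : (∃ i, t.left i = p) ∨ ∃ j, t.right j = p := by
  obtain ⟨i | j, rfl⟩ := t.position.surjective p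
  · exact .inl ⟨i, (t.position_inl i).symm⟩
  · exact .inr ⟨j, (t.position_inr j).symm⟩

/-- The word obtained by shuffling the words `u` and `v`. -/
def merge (u : Fin m → ι) (v : Fin n → ι) : Fin (m + n) → ι := Sum.elim u v ∘ t.position.symm

section merge

variable (u : Fin m → ι) (v : Fin n → ι)

theorem merge_left (i : Fin m) : t.merge u v (t.left i) = u i := by
  rw [merge, ← position_inl, Function.comp_apply, Equiv.symm_apply_apply, Sum.elim_inl]

theorem merge_right (j : Fin n) : t.merge u v (t.right j) = v j := by
  rw [merge, ← position_inr, Function.comp_apply, Equiv.symm_apply_apply, Sum.elim_inr]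

theorem merge_comp_left : t.merge u v ∘ t.left = u := funext (t.merge_left u v)

theorem merge_comp_right : t.merge u v ∘ t.right = v := funext (t.merge_right u v)

theorem merge_comp (w : Fin (m + n) → ι) : t.merge (w ∘ t.left) (w ∘ t.right) = w := by
  funext p
  rcases t.eq_left_or_eq_right p with ⟨i, rfl⟩ | ⟨j, rfl⟩
  · exact t.merge_left _ _ i
  · exact t.merge_right _ _ j

end merge

theorem toLex_merge_le_toLex_merge [LinearOrder ι] {u u' : Fin m → ι} {v v' : Fin n → ι}
    (hu : toLex u ≤ toLex u') (hv : toLex v ≤ toLex v') :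
    toLex (t.merge u v) ≤ toLex (t.merge u' v') := by
  by_contra! hlt
  obtain ⟨p, heq, hp⟩ := hlt
  simp only [Pi.toLex_apply] at heq hp
  rcases t.eq_left_or_eq_right p with ⟨i, rfl⟩ | ⟨j, rfl⟩
  · refine hu.not_gt ⟨i, fun i' hi' => ?_, by rwa [merge_left, merge_left] at hp⟩
    have h := heq _ (t.left.strictMono hi')
    rwa [merge_left, merge_left] at h
  · refine hv.not_gt ⟨j, fun j' hj' => ?_, by rwa [merge_right, merge_right] at hp⟩
    have h := heq _ (t.right.strictMono hj')
    rwa [merge_right, merge_right] at h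

/-- Among the shuffles of the leading words `u` of `f` and `v` of `g`, let `w` be the largest one.
Every decomposition of `w` into words that contributes to the sum is `(u, v)`, so that the sum is a
positive multiple of `f u * g v`. -/
theorem exists_sum_mul_ne_zero {L : Type*} [Semiring L] [NoZeroDivisors L] [CharZero L]
    {f : (Fin m → ι) → L} {g : (Fin n → ι) → L} (hf : f.support.Finite) (hg : g.support.Finite)
    (hf0 : f ≠ 0) (hg0 : g ≠ 0) :
    ∃ w, ∑ t : Shuffle m n, f (w ∘ t.left) * g (w ∘ t.right) ≠ 0 := by
  classical
  let _ : LinearOrder ι := IsWellOrder.linearOrder WellOrderingRel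
  obtain ⟨u, hu, hu_max⟩ := f.support.exists_max_image toLex hf
    (Function.support_nonempty_iff.mpr hf0)
  obtain ⟨v, hv, hv_max⟩ := g.support.exists_max_image toLex hg
    (Function.support_nonempty_iff.mpr hg0)
  have : Nonempty (Shuffle m n) := by
    rw [← Fintype.card_pos_iff, card_shuffle]
    exact Nat.choose_pos (Nat.le_add_right m n)
  obtain ⟨t₀, ht₀⟩ := Finite.exists_max fun t : Shuffle m n => toLex (t.merge u v)
  let w := t₀.merge u v
  have hterm (t : Shuffle m n) : f (w ∘ t.left) * g (w ∘ t.right) =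
      if t.merge u v = w then f u * g v else 0 := by
    split_ifs with h
    · rw [← h, merge_comp_left, merge_comp_right]
    · by_contra hne
      refine h (toLex_inj.mp ((ht₀ t).antisymm ?_))
      change toLex w ≤ _
      rw [← t.merge_comp w]
      exact t.toLex_merge_le_toLex_merge (hu_max _ (left_ne_zero_of_mul hne))
        (hv_max _ (right_ne_zero_of_mul hne))
  refine ⟨w, ?_⟩
  rw [Finset.sum_congr rfl fun t _ => hterm t, ← Finset.sum_filter, Finset.sum_const,
    nsmul_eq_mul]
  have hcard : Finset.card {t : Shuffle m n | t.merge u v = w} ≠ 0 :=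
    Finset.card_ne_zero.mpr ⟨t₀, Finset.mem_filter.mpr ⟨Finset.mem_univ _, rfl⟩⟩
  exact mul_ne_zero (Nat.cast_ne_zero.mpr hcard) (mul_ne_zero hu hv)

theorem exists_eq_cons_succ_of_strictMono {r k : ℕ} {F : Fin (r + 1) → Fin (k + 1)}
    (hF : StrictMono F) (h0 : F 0 = 0) :
    ∃ f : Fin r → Fin k, StrictMono f ∧ F = Fin.cons 0 (Fin.succ ∘ f) := by
  have hne (i : Fin r) : F i.succ ≠ 0 := h0 ▸ hF.injective.ne (Fin.succ_ne_zero i)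
  refine ⟨fun i => (F i.succ).pred (hne i), fun i i' h => ?_, funext fun i => ?_⟩
  · exact Fin.pred_lt_pred_iff.mpr (hF (Fin.succ_lt_succ_iff.mpr h))
  · induction i using Fin.cases with
    | zero => exact h0
    | succ i => simp

/-- The stuffle without overlaps that is given by a shuffle. -/
def toStuffle : Stuffle m n where
  k := m + n
  F := Fin.cons 0 (Fin.succ ∘ t.left)
  G := Fin.cons 0 (Fin.succ ∘ t.right)
  monoF := MixableShuffle.strictMono_cons t.left.strictMono
  monoG := MixableShuffle.strictMono_cons t.right.strictMono
  F0 := rfl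
  G0 := rfl
  surj l := by
    induction l using Fin.cases with
    | zero => exact .inl ⟨0, rfl⟩
    | succ p =>
      exact (t.eq_left_or_eq_right p).imp (fun ⟨i, hi⟩ => ⟨i.succ, congrArg Fin.succ hi⟩)
        fun ⟨j, hj⟩ => ⟨j.succ, congrArg Fin.succ hj⟩

theorem left_injective : Function.Injective (left : Shuffle m n → Fin m ↪o Fin (m + n)) :=
  fun t t' h => Subtype.ext (Finset.coe_injective (by
    rw [← t.1.range_orderEmbOfFin t.2, ← t'.1.range_orderEmbOfFin t'.2]
    exact congrArg (fun e : Fin m ↪o Fin (m + n) => Set.range e) h))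

theorem toStuffle_injective : Function.Injective (toStuffle : Shuffle m n → Stuffle m n) := by
  intro t t' h
  have hF : (Fin.cons 0 (Fin.succ ∘ t.left) : Fin (m + 1) → Fin (m + n + 1)) =
      Fin.cons 0 (Fin.succ ∘ t'.left) := by
    injection h
  refine left_injective (DFunLike.coe_injective ?_)
  exact (Fin.succ_injective _).comp_left (Fin.cons_right_injective _ hF)

theorem exists_toStuffle_eq (s : Stuffle m n) (hs : s.k = m + n) :
    ∃ t : Shuffle m n, t.toStuffle = s := by
  obtain ⟨k, F, G, hF, hG, hF0, hG0, hsurj⟩ := s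
  obtain rfl : k = m + n := hs
  obtain ⟨f, hf, rfl⟩ := exists_eq_cons_succ_of_strictMono hF hF0
  obtain ⟨g, hg, rfl⟩ := exists_eq_cons_succ_of_strictMono hG hG0
  have hfg : Function.Surjective (Sum.elim f g) := fun p => by
    rcases hsurj p.succ with ⟨i, hi⟩ | ⟨j, hj⟩
    · induction i using Fin.cases with
      | zero => exact absurd hi.symm (Fin.succ_ne_zero p)
      | succ i => exact ⟨.inl i, Fin.succ_injective _ hi⟩
    · induction j using Fin.cases with
      | zero => exact absurd hj.symm (Fin.succ_ne_zero p)
      | succ j => exact ⟨.inr j, Fin.succ_injective _ hj⟩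
  have hinj : Function.Injective (Sum.elim f g) :=
    (Fintype.bijective_iff_surjective_and_card _).mpr ⟨hfg, by simp⟩ |>.injective
  let t : Shuffle m n := ⟨Finset.univ.map ⟨f, hf.injective⟩, by simp⟩
  have hleft : f = t.left := Finset.orderEmbOfFin_unique t.2 (fun i => by simp [t]) hf
  have hright : g = t.right := Finset.orderEmbOfFin_unique t.card_compl (fun i => by
    simpa [t] using fun j => hinj.ne (a₁ := .inl j) (a₂ := .inr i) Sum.inl_ne_inr) hg
  exact ⟨t, by simp only [toStuffle, hleft, hright]⟩

theorem push_mul_push {A : Type*} [CommRing A] (x : Fin (m + 1) → A) (y : Fin (n + 1) → A) :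
    push (Fin.cons 0 (Fin.succ ∘ t.left) : Fin (m + 1) → Fin (m + n + 1)) x *
        push (Fin.cons 0 (Fin.succ ∘ t.right) : Fin (n + 1) → Fin (m + n + 1)) y =
      Fin.cons (x 0 * y 0) (t.merge (Fin.tail x) (Fin.tail y)) := by
  have hF := push_apply_of_injective t.toStuffle.monoF.injective x
  have hG := push_apply_of_injective t.toStuffle.monoG.injective y
  funext l
  rw [Pi.mul_apply]
  induction l using Fin.cases with
  | zero => exact congrArg₂ (· * ·) (hF 0) (hG 0)
  | succ p =>
    rw [Fin.cons_succ]
    rcases t.eq_left_or_eq_right p with ⟨i, rfl⟩ | ⟨j, rfl⟩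
    · rw [merge_left, push_apply_of_notMem_range y, mul_one]
      · exact hF i.succ
      · rintro ⟨j, hj⟩
        induction j using Fin.cases with
        | zero => exact Fin.succ_ne_zero _ hj.symm
        | succ j => exact t.left_ne_right i j (Fin.succ_injective _ hj).symm
    · rw [merge_right, push_apply_of_notMem_range x, one_mul]
      · exact hG j.succ
      · rintro ⟨i, hi⟩
        induction i using Fin.cases with
        | zero => exact Fin.succ_ne_zero _ hi.symm
        | succ i => exact t.left_ne_right i j (Fin.succ_injective _ hi)

end Shuffle

theorem Stuffle.sum_eq_sum_shuffle_add {m n : ℕ} {N : Type*} [AddCommMonoid N]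
    (h : Stuffle m n → N) :
    ∑ s, h s = ∑ t : Shuffle m n, h t.toStuffle + ∑ s with s.k ≠ m + n, h s := by
  classical
  have himage : Finset.univ.image (Shuffle.toStuffle (m := m) (n := n)) =
      ({s | s.k = m + n} : Finset (Stuffle m n)) := by
    ext s
    simp only [Finset.mem_image, Finset.mem_univ, true_and, Finset.mem_filter_univ]
    exact ⟨fun ⟨t, ht⟩ => ht ▸ rfl, Shuffle.exists_toStuffle_eq s⟩
  rw [← Finset.sum_image (f := h) Shuffle.toStuffle_injective.injOn, himage,
    Finset.sum_filter_add_sum_filter_not]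

namespace Sha

variable {C : Type*} [CommRing C] {lam : C} {A : Type*} [CommRing A] [Algebra C A] {m n : ℕ}

theorem pure_mul_pure_eq_sum_shuffle_add (x : Fin (m + 1) → A) (y : Fin (n + 1) → A) :
    pure C lam x * pure C lam y =
      ∑ t : Shuffle m n,
        pure C lam (k := m + n) (Fin.cons (x 0 * y 0) (t.merge (Fin.tail x) (Fin.tail y))) +
      ∑ s : Stuffle m n with s.k ≠ m + n,
        lam ^ (m + n - s.k) • pure C lam (push s.F x * push s.G y) := by
  rw [pure_mul_pure_stuffle, Stuffle.sum_eq_sum_shuffle_add]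
  refine congrArg (· + _) (Finset.sum_congr rfl fun t _ => ?_)
  change lam ^ (m + n - (m + n)) • pure C lam (_ : Fin (m + n + 1) → A) = _
  rw [Nat.sub_self, pow_zero, one_smul]
  exact congrArg (pure C lam) (t.push_mul_push x y)

end Sha

theorem Shuffle.prod_eq {M : Type*} [CommMonoid M] {m n : ℕ} (t : Shuffle m n)
    (h : Fin (m + n) → M) : ∏ p, h p = (∏ i, h (t.left i)) * ∏ j, h (t.right j) := by
  rw [← t.position.prod_comp, Fintype.prod_sum_type]
  simp only [position_inl, position_inr]

namespace Sha

section proj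

variable {C : Type*} [CommRing C] {lam : C} {A : Type*} [CommRing A] [Algebra C A] {m n k : ℕ}

/-- The projection onto `A^{⊗ (k + 1)}`. -/
noncomputable def proj (k : ℕ) : Sha C lam A →ₗ[C] ⨂[C]^(k + 1) A :=
  DirectSum.component C ℕ (fun k => ⨂[C]^(k + 1) A) k

theorem proj_incl (a : ⨂[C]^(k + 1) A) : proj k (incl C lam A k a) = a :=
  DirectSum.component.lof_self C (M := fun k => ⨂[C]^(k + 1) A) k a

theorem incl_injective : Function.Injective (incl C lam A k) :=
  Function.LeftInverse.injective proj_incl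

theorem proj_incl_of_ne (h : m ≠ k) (a : ⨂[C]^(m + 1) A) : proj k (incl C lam A m a) = 0 :=
  DFinsupp.single_eq_of_ne h.symm

theorem proj_pure (x : Fin (k + 1) → A) : proj k (pure C lam x) = PiTensorProduct.tprod C x :=
  proj_incl _

theorem exists_top_degree {x : Sha C lam A} (hx : x ≠ 0) :
    ∃ m, proj m x ≠ 0 ∧ ∀ k, m < k → proj k x = 0 := by
  classical
  let x' : Π₀ k : ℕ, ⨂[C]^(k + 1) A := x
  have hne : x'.support.Nonempty :=
    Finset.nonempty_iff_ne_empty.mpr fun h => hx (DFinsupp.support_eq_empty.mp h)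
  refine ⟨x'.support.max' hne, DFinsupp.mem_support_iff.mp (x'.support.max'_mem hne),
    fun k hk => ?_⟩
  by_contra hk'
  exact hk.not_ge (x'.support.le_max' k (DFinsupp.mem_support_iff.mpr hk'))

theorem sum_range_incl_proj {x : Sha C lam A} (hx : ∀ k, m < k → proj k x = 0) :
    ∑ k ∈ Finset.range (m + 1), incl C lam A k (proj k x) = x := by
  classical
  let x' : Π₀ k : ℕ, ⨂[C]^(k + 1) A := x
  refine (Finset.sum_subset (s₁ := x'.support) (fun k hk => ?_) fun k _ hk => ?_).symm.trans
    (DirectSum.sum_support_of x')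
  · by_contra hmk
    exact DFinsupp.mem_support_iff.mp hk (hx k (by simpa using hmk))
  · change incl C lam A k (x' k) = 0
    rw [DFinsupp.notMem_support_iff.mp hk, map_zero]

theorem linearMap₂_ext {N : Type*} [AddCommGroup N] [Module C N]
    {f g : (⨂[C]^(m + 1) A) →ₗ[C] (⨂[C]^(n + 1) A) →ₗ[C] N}
    (h : ∀ x y, f (PiTensorProduct.tprod C x) (PiTensorProduct.tprod C y) =
      g (PiTensorProduct.tprod C x) (PiTensorProduct.tprod C y)) : f = g := by
  ext x y
  exact h x y

theorem proj_pure_mul_pure (x : Fin (m + 1) → A) (y : Fin (n + 1) → A) :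
    proj (m + n) (pure C lam x * pure C lam y) =
      ∑ t : Shuffle m n, PiTensorProduct.tprod C
        (Fin.cons (x 0 * y 0) (t.merge (Fin.tail x) (Fin.tail y)) : Fin (m + n + 1) → A) := by
  rw [pure_mul_pure_eq_sum_shuffle_add, map_add, map_sum, map_sum,
    Finset.sum_eq_zero (s := Finset.univ.filter _), add_zero]
  · simp only [proj_pure]
  · intro s hs
    rw [map_smul, pure, proj_incl_of_ne (Finset.mem_filter.mp hs).2, smul_zero]

theorem proj_incl_mul_incl_of_lt (h : m + n < k) (a : ⨂[C]^(m + 1) A) (b : ⨂[C]^(n + 1) A) :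
    proj k (incl C lam A m a * incl C lam A n b) = 0 := by
  suffices ((LinearMap.mul C (Sha C lam A)).compl₁₂ (incl C lam A m) (incl C lam A n)).compr₂
      (proj k) = 0 from LinearMap.congr_fun₂ this a b
  refine linearMap₂_ext fun x y => ?_
  change proj k (pure C lam x * pure C lam y) = 0
  rw [pure_mul_pure_stuffle, map_sum]
  refine Finset.sum_eq_zero fun s _ => ?_
  rw [map_smul, pure, proj_incl_of_ne (s.k_le.trans_lt h).ne, smul_zero]

theorem proj_mul_of_forall_lt {x y : Sha C lam A} (hx : ∀ k, m < k → proj k x = 0)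
    (hy : ∀ k, n < k → proj k y = 0) :
    proj (m + n) (x * y) =
      proj (m + n) (incl C lam A m (proj m x) * incl C lam A n (proj n y)) := by
  have hle {k l : ℕ} (hk : k ∈ Finset.range (l + 1)) : k ≤ l := Finset.mem_range_succ_iff.mp hk
  conv_lhs => rw [← sum_range_incl_proj hx, ← sum_range_incl_proj hy]
  rw [Finset.sum_mul_sum, map_sum, Finset.sum_eq_single_of_mem m (Finset.self_mem_range_succ m),
    map_sum, Finset.sum_eq_single_of_mem n (Finset.self_mem_range_succ n)]
  · exact fun k hk hkn => proj_incl_mul_incl_of_lt (by have := hle hk; omega) _ _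
  · intro i hi him
    rw [map_sum]
    exact Finset.sum_eq_zero fun k hk =>
      proj_incl_mul_incl_of_lt (by have := hle hi; have := hle hk; omega) _ _

end proj

end Sha

section wordCoeff

variable {C : Type*} [CommRing C] {A : Type*} [CommRing A] [Algebra C A] {L : Type*} [CommRing L]
  [Algebra C L] {ι : Type*} (φ : A →ₐ[C] L) (c : A →ₗ[C] ι →₀ L) {m n : ℕ}

/-- The coefficient of a tensor at the word `w`, where a tensor is read as a combination of words:
the factors of `a₀ ⊗ a₁ ⊗ ⋯ ⊗ aₘ` other than the first are expanded by means of the coordinates `c`,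
and the first one contributes the coefficient `φ a₀`. -/
noncomputable def wordCoeff (w : Fin m → ι) : (⨂[C]^(m + 1) A) →ₗ[C] L :=
  PiTensorProduct.lift <| (MultilinearMap.mkPiAlgebra C (Fin (m + 1)) L).compLinearMap
    (Fin.cons φ.toLinearMap fun i => Finsupp.lapply (w i) ∘ₗ c)

theorem wordCoeff_tprod (w : Fin m → ι) (x : Fin (m + 1) → A) :
    wordCoeff φ c w (PiTensorProduct.tprod C x) = φ (x 0) * ∏ i, c (x i.succ) (w i) := by
  rw [wordCoeff, PiTensorProduct.lift.tprod, MultilinearMap.compLinearMap_apply,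
    MultilinearMap.mkPiAlgebra_apply, Fin.prod_univ_succ]
  rfl

theorem finite_support_wordCoeff (a : ⨂[C]^(m + 1) A) :
    (Function.support fun w : Fin m → ι => wordCoeff φ c w a).Finite := by
  induction a using PiTensorProduct.induction_on with
  | add a b ha hb =>
    simp only [map_add]
    exact (ha.union hb).subset (Function.support_add _ _)
  | smul_tprod r x =>
    refine (Set.Finite.pi fun i => (c (x (Fin.succ i))).hasFiniteSupport).subset fun w hw i _ hi =>
      hw ?_
    change wordCoeff φ c w (r • _) = 0
    rw [map_smul, wordCoeff_tprod, Finset.prod_eq_zero (Finset.mem_univ i) hi, mul_zero, smul_zero]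

theorem wordCoeff_proj_incl_mul_incl {lam : C} (w : Fin (m + n) → ι) (a : ⨂[C]^(m + 1) A)
    (b : ⨂[C]^(n + 1) A) :
    wordCoeff φ c w (Sha.proj (m + n) (Sha.incl C lam A m a * Sha.incl C lam A n b)) =
      ∑ t : Shuffle m n, wordCoeff φ c (w ∘ t.left) a * wordCoeff φ c (w ∘ t.right) b := by
  suffices ((LinearMap.mul C _).compl₁₂ (Sha.incl C lam A m) (Sha.incl C lam A n)).compr₂
        (wordCoeff φ c w ∘ₗ Sha.proj (m + n)) =
      ∑ t : Shuffle m n,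
        (LinearMap.mul C L).compl₁₂ (wordCoeff φ c (w ∘ t.left)) (wordCoeff φ c (w ∘ t.right)) by
    simpa using LinearMap.congr_fun₂ this a b
  refine Sha.linearMap₂_ext fun x y => ?_
  simp only [LinearMap.sum_apply, LinearMap.compr₂_apply, LinearMap.compl₁₂_apply,
    LinearMap.mul_apply', LinearMap.comp_apply, wordCoeff_tprod]
  change wordCoeff φ c w (Sha.proj _ (Sha.pure C lam x * Sha.pure C lam y)) = _
  rw [Sha.proj_pure_mul_pure, map_sum]
  refine Finset.sum_congr rfl fun t _ => ?_
  rw [wordCoeff_tprod, t.prod_eq]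
  simp only [Fin.cons_zero, Fin.cons_succ, t.merge_left, t.merge_right, map_mul]
  exact mul_mul_mul_comm _ _ _ _

theorem noZeroDivisors_of_exists_wordCoeff_ne_zero [NoZeroDivisors L] [CharZero L]
    {lam : C}
    (hc : ∀ {m : ℕ} {a : ⨂[C]^(m + 1) A}, a ≠ 0 → ∃ w : Fin m → ι, wordCoeff φ c w a ≠ 0) :
    NoZeroDivisors (Sha C lam A) where
  eq_zero_or_eq_zero_of_mul_eq_zero {x y} hxy := by
    by_contra! hne
    obtain ⟨m, hxm, hx⟩ := Sha.exists_top_degree hne.1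
    obtain ⟨n, hyn, hy⟩ := Sha.exists_top_degree hne.2
    obtain ⟨u, hu⟩ := hc hxm
    obtain ⟨v, hv⟩ := hc hyn
    obtain ⟨w, hw⟩ := Shuffle.exists_sum_mul_ne_zero (finite_support_wordCoeff φ c (Sha.proj m x))
      (finite_support_wordCoeff φ c (Sha.proj n y)) (fun h => hu (congrFun h u))
      fun h => hv (congrFun h v)
    rw [← wordCoeff_proj_incl_mul_incl (lam := lam), ← Sha.proj_mul_of_forall_lt hx hy, hxy,
      map_zero, map_zero] at hw
    exact hw rfl

end wordCoeff

theorem multilinearMap_mem_of_forall_mem_span_range {C M N ι κ : Type*} [CommRing C]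
    [AddCommGroup M] [Module C M] [AddCommGroup N] [Module C N] [Finite κ]
    (f : MultilinearMap C (fun _ : κ => M) N) {e : ι → M} {S : Submodule C N}
    (hf : ∀ w : κ → ι, f (e ∘ w) ∈ S) {y : κ → M}
    (hy : ∀ i, y i ∈ Submodule.span C (Set.range e)) : f y ∈ S := by
  classical
  have := Fintype.ofFinite κ
  choose l hl using fun i => Finsupp.mem_span_range_iff_exists_finsupp.mp (hy i)
  obtain rfl : (fun i => ∑ i' ∈ (l i).support, l i i' • e i') = y := funext hl
  rw [f.map_sum_finset fun i i' => l i i' • e i']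
  refine Submodule.sum_mem _ fun r _ => ?_
  rw [f.map_smul_univ (fun i => l i (r i)) fun i => e (r i)]
  exact S.smul_mem _ (hf r)

section wordSum

variable {C : Type*} [CommRing C] {A : Type*} [CommRing A] [Algebra C A] {ι : Type*} {e : ι → A}
  {m : ℕ}

/-- The tensor `∑ w, f w ⊗ e (w 0) ⊗ ⋯ ⊗ e (w (m - 1))` with given coefficients `f`. -/
noncomputable def wordSum (C : Type*) [CommRing C] {A : Type*} [CommRing A] [Algebra C A]
    {ι : Type*} (e : ι → A) (m : ℕ) : ((Fin m → ι) →₀ A) →ₗ[C] ⨂[C]^(m + 1) A :=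
  Finsupp.lsum C fun w =>
    (PiTensorProduct.tprod C : MultilinearMap C (fun _ => A) _).toLinearMap (Fin.cons 0 (e ∘ w)) 0

theorem wordSum_single (w : Fin m → ι) (a : A) :
    wordSum C e m (Finsupp.single w a) = PiTensorProduct.tprod C (Fin.cons a (e ∘ w)) := by
  rw [wordSum, Finsupp.lsum_single, MultilinearMap.toLinearMap_apply, Fin.update_cons_zero]

theorem wordCoeff_wordSum {L : Type*} [CommRing L] [Algebra C L] (φ : A →ₐ[C] L)
    {c : A →ₗ[C] ι →₀ L} (hc : ∀ i, c (e i) = Finsupp.single i 1) (f : (Fin m → ι) →₀ A)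
    (w : Fin m → ι) : wordCoeff φ c w (wordSum C e m f) = φ (f w) := by
  classical
  induction f using Finsupp.induction_linear with
  | zero => simp
  | add f g hf hg => rw [map_add, map_add, hf, hg, Finsupp.add_apply, map_add]
  | single u a =>
    simp only [wordSum_single, wordCoeff_tprod, Fin.cons_zero, Fin.cons_succ, Function.comp_apply,
      hc]
    rcases eq_or_ne u w with rfl | h
    · simp
    · obtain ⟨i, hi⟩ := Function.ne_iff.mp h
      have hi0 : Finsupp.single (u i) (1 : L) (w i) = 0 := Finsupp.single_eq_of_ne (Ne.symm hi)
      rw [Finset.prod_eq_zero (Finset.mem_univ i) hi0, mul_zero,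
        Finsupp.single_eq_of_ne h.symm, map_zero]

theorem exists_smul_mem_range_wordSum {S : Submonoid C}
    (he : ∀ a, ∃ r ∈ S, r • a ∈ Submodule.span C (Set.range e)) (z : ⨂[C]^(m + 1) A) :
    ∃ r ∈ S, r • z ∈ LinearMap.range (wordSum C e m) := by
  induction z using PiTensorProduct.induction_on with
  | add x y hx hy =>
    obtain ⟨r, hr, hx⟩ := hx
    obtain ⟨s, hs, hy⟩ := hy
    refine ⟨r * s, mul_mem hr hs, ?_⟩
    rw [smul_add]
    refine add_mem ?_ ?_
    · rw [mul_comm, mul_smul]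
      exact Submodule.smul_mem _ _ hx
    · rw [mul_smul]
      exact Submodule.smul_mem _ _ hy
  | smul_tprod a x =>
    choose r hr hx using fun i : Fin m => he (x i.succ)
    have h := multilinearMap_mem_of_forall_mem_span_range
      ((PiTensorProduct.tprod C : MultilinearMap C (fun _ : Fin (m + 1) => A) _).curryLeft (x 0))
      (S := LinearMap.range (wordSum C e m))
      (fun w => ⟨Finsupp.single w (x 0), wordSum_single w (x 0)⟩) hx
    rw [MultilinearMap.map_smul_univ, MultilinearMap.curryLeft_apply] at h
    refine ⟨∏ i, r i, prod_mem fun i _ => hr i, ?_⟩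
    rw [smul_comm, ← Fin.cons_self_tail x]
    exact Submodule.smul_mem _ _ h

theorem exists_wordCoeff_ne_zero {L : Type*} [CommRing L] [Algebra C L] {φ : A →ₐ[C] L}
    (hφ : Function.Injective φ) {c : A →ₗ[C] ι →₀ L} (hc : ∀ i, c (e i) = Finsupp.single i 1)
    {S : Submonoid C} (he : ∀ a, ∃ r ∈ S, r • a ∈ Submodule.span C (Set.range e))
    {z : ⨂[C]^(m + 1) A} (hz : ∀ r ∈ S, r • z ≠ 0) : ∃ w, wordCoeff φ c w z ≠ 0 := by
  obtain ⟨r, hr, f, hf⟩ := exists_smul_mem_range_wordSum he z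
  have hf0 : f ≠ 0 := by
    rintro rfl
    exact hz r hr (by rw [← hf, map_zero])
  obtain ⟨w, hw⟩ := Finsupp.ne_iff.mp hf0
  refine ⟨w, fun h => hw (hφ ?_)⟩
  rw [← wordCoeff_wordSum φ hc, hf, map_smul, h, smul_zero, Finsupp.zero_apply, map_zero]

end wordSum

section coordinates

theorem exists_coordinates (R K : Type*) [CommRing R] [IsDomain R] [Field K] [Algebra R K]
    [IsFractionRing R K] (M : Type v) [AddCommGroup M] [Module R M] [Module.IsTorsionFree R M] :
    ∃ (κ : Type v) (e : κ → M) (c : M →ₗ[R] κ →₀ K), (∀ k, c (e k) = Finsupp.single k 1) ∧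
      ∀ x, ∃ r : R, r ≠ 0 ∧ r • x ∈ Submodule.span R (Set.range e) := by
  let i : M →ₗ[R] TensorProduct R K M := TensorProduct.mk R K M 1
  have hinj : Function.Injective i :=
    (IsLocalizedModule.injective_iff_isRegular (nonZeroDivisors R) i).mpr fun r =>
      IsSMulRegular.of_ne_zero (nonZeroDivisors.coe_ne_zero r)
  have htop : Submodule.span K (Set.range i) = ⊤ := by
    rw [← Set.image_univ]
    exact span_eq_top_of_isLocalizedModule K (nonZeroDivisors R) i Submodule.span_univ
  obtain ⟨κ, e, -, hspan, hli⟩ := exists_linearIndependent' K i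
  let b := Module.Basis.mk hli (hspan.trans htop).ge
  refine ⟨κ, e, b.repr.toLinearMap.restrictScalars R ∘ₗ i, fun k => ?_, fun x => ?_⟩
  · have hk : b k = i (e k) := Module.Basis.mk_apply hli _ k
    exact (congrArg b.repr hk.symm).trans (b.repr_self k)
  · obtain ⟨r, hr⟩ := multiple_mem_span_of_mem_localization_span (nonZeroDivisors R) K
      (Set.range (i ∘ e)) (i x) (by rw [hspan, htop]; trivial)
    refine ⟨r, nonZeroDivisors.coe_ne_zero r, ?_⟩
    rw [Set.range_comp, ← Submodule.map_span, Submonoid.smul_def, ← map_smul] at hr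
    exact (hinj.mem_set_image (s := Submodule.span R (Set.range e))).mp hr

theorem exists_coordinates_fractionRing (C : Type*) (B : Type v) [CommRing C] [CommRing B]
    [IsDomain B] [Algebra C B] :
    ∃ (κ : Type v) (e : κ → B) (c : B →ₗ[C] κ →₀ FractionRing B),
      (∀ k, c (e k) = Finsupp.single k 1) ∧
      ∀ b, ∃ r ∈ (nonZeroDivisors B).comap (algebraMap C B),
        r • b ∈ Submodule.span C (Set.range e) := by
  let R := (⊥ : Subalgebra C B)
  let _ := FractionRing.liftAlgebra R (FractionRing B)
  obtain ⟨κ, e, c, hce, he⟩ := exists_coordinates R (FractionRing R) B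
  refine ⟨κ, e, (Finsupp.mapRange.linearMap
    ((Algebra.linearMap (FractionRing R) (FractionRing B)).restrictScalars R) ∘ₗ
      c).restrictScalars C, fun k => ?_, fun b => ?_⟩
  · simp [hce]
  · obtain ⟨⟨_, hr⟩, hr0, hb⟩ := he b
    obtain ⟨r, rfl⟩ := Algebra.mem_bot.mp hr
    have hC : Function.Surjective (algebraMap C R) := fun ⟨_, hx⟩ =>
      (Algebra.mem_bot.mp hx).imp fun _ hr => Subtype.ext hr
    refine ⟨r, mem_nonZeroDivisors_of_ne_zero fun h => hr0 (Subtype.ext h), ?_⟩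
    rw [← Submodule.restrictScalars_span C R hC, Submodule.restrictScalars_mem, Algebra.smul_def]
    exact hb

end coordinates

theorem torsionModulo_eq_singleton_zero_iff {C : Type*} [CommRing C] {K : Ideal C} (hK : K ≠ ⊤)
    {N : Type*} [AddCommGroup N] [Module C N] :
    torsionModulo K N = {0} ↔ ∀ r ∉ K, ∀ x : N, r • x = 0 → x = 0 := by
  refine ⟨fun h r hr x hx => ?_, fun h => Set.Subset.antisymm ?_ ?_⟩
  · have hx' : x ∈ torsionModulo K N := ⟨r, hr, hx⟩
    rwa [h] at hx'
  · rintro x ⟨r, hr, hx⟩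
    exact h r hr x hx
  · rintro _ rfl
    exact ⟨1, (Ideal.ne_top_iff_one K).mp hK, smul_zero 1⟩

namespace Sha

theorem jHom_injective {C : Type*} [CommRing C] {lam : C} {A : Type*} [CommRing A] [Algebra C A] :
    Function.Injective (jHom C lam A) := by
  intro a b h
  rw [jHom_apply, jHom_apply, j_eq_incl, j_eq_incl] at h
  exact (PiTensorProduct.subsingletonEquiv (0 : Fin 1)).symm.injective (incl_injective h)

theorem isDomain_of_torsionFree {C : Type*} [CommRing C] {lam : C} {B : Type v} [CommRing B]
    [Algebra C B] [IsDomain B] [CharZero B]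
    (h : ∀ (m : ℕ) (r : C), algebraMap C B r ≠ 0 → ∀ x : ⨂[C]^(m + 1) B, r • x = 0 → x = 0) :
    IsDomain (Sha C lam B) := by
  have hinj := IsFractionRing.injective B (FractionRing B)
  have : CharZero (FractionRing B) := charZero_of_injective_algebraMap hinj
  obtain ⟨κ, e, c, hce, he⟩ := exists_coordinates_fractionRing C B
  have : NoZeroDivisors (Sha C lam B) :=
    noZeroDivisors_of_exists_wordCoeff_ne_zero (IsScalarTower.toAlgHom C B (FractionRing B)) c
      fun {m a} ha => exists_wordCoeff_ne_zero hinj hce he fun r hr hra =>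
        ha (h m r (nonZeroDivisors.ne_zero hr) a hra)
  have : Nontrivial (Sha C lam B) := (jHom_injective (lam := lam)).nontrivial
  exact NoZeroDivisors.to_isDomain _

section ones

/-- The tensor `1 ⊗ ⋯ ⊗ 1` with `n + 1` factors, which is `P ^ n` applied to `1`. -/
noncomputable def ones (C : Type*) [CommRing C] (lam : C) (B : Type*) [CommRing B] [Algebra C B]
    (n : ℕ) : Sha C lam B :=
  pure C lam (k := n) 1

variable {C : Type*} [CommRing C] {lam : C} {B : Type*} [CommRing B] [Algebra C B]

theorem exists_ones_one_mul_ones (n : ℕ) : ∃ r : C, ones C lam B 1 * ones C lam B n =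
    (n + 1) • ones C lam B (n + 1) + r • ones C lam B n := by
  have hmerge (t : Shuffle 1 n) : (Fin.cons ((1 : Fin (1 + 1) → B) 0 * (1 : Fin (n + 1) → B) 0)
      (t.merge (Fin.tail (1 : Fin (1 + 1) → B)) (Fin.tail (1 : Fin (n + 1) → B))) :
      Fin (1 + n + 1) → B) = 1 := by
    rw [Pi.one_apply, Pi.one_apply, mul_one]
    exact (congrArg (Fin.cons 1) (t.merge_comp 1)).trans (Fin.cons_self_tail 1)
  have hrest (s : Stuffle 1 n) (hs : s.k ≠ 1 + n) : s.k = n := by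
    have hle : n + 1 ≤ s.k + 1 := by
      simpa only [Fintype.card_fin] using Fintype.card_le_of_injective s.G s.monoG.injective
    have := s.k_le
    omega
  refine ⟨∑ s : Stuffle 1 n with s.k ≠ 1 + n, lam ^ (1 + n - s.k), ?_⟩
  rw [ones, ones, pure_mul_pure_eq_sum_shuffle_add, Finset.sum_smul]
  simp only [hmerge, push_one, mul_one, Finset.sum_const, Finset.card_univ, Shuffle.card_shuffle,
    Nat.choose_one_right]
  congr 1
  · rw [add_comm 1 n, ones]
  · refine Finset.sum_congr rfl fun s hs => ?_
    rw [← ones, hrest s (Finset.mem_filter.mp hs).2, ones]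

theorem exists_factorial_smul_ones_eq_prod (lam : C) (B : Type*) [CommRing B] [Algebra C B] :
    ∃ r : ℕ → C, ∀ n, n.factorial • ones C lam B n =
      ∏ k ∈ Finset.range n, (ones C lam B 1 - r k • 1) := by
  choose r hr using exists_ones_one_mul_ones (lam := lam) (B := B)
  refine ⟨r, fun n => ?_⟩
  induction n with
  | zero => exact one_smul ℕ _
  | succ n ih =>
    rw [Finset.prod_range_succ, ← ih, mul_comm, mul_smul_comm, sub_mul, hr, smul_mul_assoc, one_mul,
      add_sub_cancel_right, smul_smul, mul_comm, Nat.factorial_succ]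

theorem ones_one_sub_smul_one_ne_zero [Nontrivial B] (r : C) : ones C lam B 1 - r • 1 ≠ 0 := by
  intro h
  replace h := congrArg (PiTensorProduct.lift (MultilinearMap.mkPiAlgebra C (Fin 2) B) ∘ proj 1) h
  simp only [Function.comp_apply, map_sub, map_smul, map_zero] at h
  rw [ones, proj_pure, one_def, pure, proj_incl_of_ne zero_ne_one, map_zero, smul_zero, sub_zero,
    PiTensorProduct.lift.tprod, MultilinearMap.mkPiAlgebra_apply] at h
  simp only [Pi.one_apply, Finset.prod_const_one, one_ne_zero] at h

theorem charZero_of_isDomain [Nontrivial B] [IsDomain (Sha C lam B)] : CharZero B := by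
  refine charZero_of_inj_zero fun n hn => ?_
  have hn' : (n : Sha C lam B) = 0 := by
    rw [← map_natCast (jHom C lam B), hn, map_zero]
  by_contra h0
  obtain ⟨r, hr⟩ := exists_factorial_smul_ones_eq_prod lam B
  refine Finset.prod_ne_zero_iff.mpr (fun k _ => ones_one_sub_smul_one_ne_zero (r k))
    ((hr n).symm.trans ?_)
  obtain ⟨d, hd⟩ := Nat.dvd_factorial (Nat.pos_of_ne_zero h0) le_rfl
  rw [hd, nsmul_eq_mul, Nat.cast_mul, hn', zero_mul, zero_mul]

end ones

theorem eq_zero_of_smul_eq_zero {C : Type*} [CommRing C] (lam : C) {B : Type*} [CommRing B]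
    [Algebra C B] [NoZeroDivisors (Sha C lam B)] {k : ℕ} {r : C} (hr : algebraMap C B r ≠ 0)
    {x : ⨂[C]^(k + 1) B} (hx : r • x = 0) : x = 0 := by
  have h : jHom C lam B (algebraMap C B r) * incl C lam B k x = 0 := by
    rw [AlgHom.commutes, ← Algebra.smul_def, ← map_smul, hx, map_zero]
  have hr' : jHom C lam B (algebraMap C B r) ≠ 0 := (map_ne_zero_iff _ jHom_injective).mpr hr
  exact (map_eq_zero_iff _ incl_injective).mp ((mul_eq_zero.mp h).resolve_left hr')

theorem isDomain_iff {C : Type*} [CommRing C] (lam : C) (B : Type*) [CommRing B] [Algebra C B] :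
    IsDomain (Sha C lam B) ↔ IsDomain B ∧ CharZero B ∧
      ∀ n ≥ 1, torsionModulo (RingHom.ker (algebraMap C B)) (⨂[C]^n B) = {0} := by
  refine ⟨fun h => ?_, fun ⟨_, _, htf⟩ => isDomain_of_torsionFree fun m r hr x hx => ?_⟩
  · have hB : IsDomain B := jHom_injective.isDomain (jHom C lam B)
    refine ⟨hB, charZero_of_isDomain (C := C) (lam := lam), fun n hn => ?_⟩
    obtain ⟨k, rfl⟩ := Nat.exists_eq_add_of_le' hn
    exact (torsionModulo_eq_singleton_zero_iff (RingHom.ker_ne_top _)).mpr fun r hr x hx =>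
      eq_zero_of_smul_eq_zero lam hr hx
  · exact (torsionModulo_eq_singleton_zero_iff (RingHom.ker_ne_top _)).mp
      (htf (m + 1) (Nat.le_add_left 1 m)) r hr x hx

end Sha

end BaxterAlgebra

theorem mainTheorem6_general {C : Type*} [CommRing C] (lam : C) {A : Type*} [CommRing A]
    [Algebra C A] (I : Ideal A) :
    (BaxterAlgebra.baxterIdealSpan (BaxterAlgebra.Sha.P C lam A)
        (BaxterAlgebra.Sha.j C lam '' (I : Set A))).IsPrime ↔
      I.IsPrime ∧ CharZero (A ⧸ I) ∧
        ∀ n : ℕ, 1 ≤ n →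
          BaxterAlgebra.torsionModulo (RingHom.ker (algebraMap C (A ⧸ I)))
            (⨂[C]^n (A ⧸ I)) = {0} := by
  rw [BaxterAlgebra.Sha.isPrime_baxterIdealSpan_iff_isDomain, BaxterAlgebra.Sha.isDomain_iff,
    Ideal.Quotient.isDomain_iff_prime]

theorem mainTheorem6 {C : Type*} [CommRing C] (lam : C) {A : Type*} [CommRing A] [Algebra C A]
    (I : Ideal A) (hI : I.IsPrime) :
    (BaxterAlgebra.baxterIdealSpan (BaxterAlgebra.Sha.P C lam A)
        (BaxterAlgebra.Sha.j C lam '' (I : Set A))).IsPrime ↔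
      CharZero (A ⧸ I) ∧
        ∀ n : ℕ, 1 ≤ n →
          BaxterAlgebra.torsionModulo (RingHom.ker (algebraMap C (A ⧸ I)))
            (⨂[C]^n (A ⧸ I)) = {0} := by
  rw [mainTheorem6_general, and_iff_right hI]
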